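/- For $x\in\mathbb{R}^3$ let $B(x)$ be the closed unit ball centered at $x$, and for $X\subset\mathbb{R}^3$ let $B(X)=\bigcap_{x\in X}B(x)$. A convex body (a convex compact subset of $\mathbb{R}^3$) has \emph{constant width} if any two parallel supporting planes of it are at distance one. Let $a_1,a_2,a_3,a_4\in\mathbb{R}^3$ satisfy $|a_i-a_j|=1$ for $i\ne j$, let $R=B(\{a_1,a_2,a_3,a_4\})$ be the Reuleaux tetrahedron, and, for $\{i,j,k,l\}=\{1,2,3,4\}$, let $e_{ij}=R\cap\partial B(a_k)\cap\partial B(a_l)$ be its edge joining $a_i$ to $a_j$. \emph{Surgery near $e_{ij}$}: let $\gamma_k\subset\partial B(a_k)$ and $\gamma_l\subset\partial B(a_l)$ be the geodesics (minor great-circle arcs) joining $a_i$ to $a_j$; replace the region of $\partial R$ that contains $e_{ij}\setminus\{a_i,a_j\}$ and is bounded by $\gamma_k\cup\gamma_l$ (the component of $\partial R\setminus(\gamma_k\cup\gamma_l)$ containing $e_{ij}\setminus\{a_i,a_j\}$) by the piece of a spindle torus that is swept out by rotating $\gamma_k$ into $\gamma_l$ about the line through $a_i$ and $a_j$, through an angle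 less than $\pi$. \textbf{Corollary (Meissner tetrahedra have constant width).} The surface obtained from $\partial R$ by surgery near three edges of $R$ that share a common face, or that share a common vertex, is the boundary of exactly one convex body, a \emph{Meissner tetrahedron}, and this convex body has constant width. If the three edges are $e_{23},e_{24},e_{34}$, which share the face opposite $a_1$, then it equals $$B(\{a_1,a_2,a_3,a_4\}\cup e_{12}\cup e_{13}\cup e_{14})=B(e_{12}\cup e_{13}\cup e_{14}).$$ If the three edges are $e_{12},e_{13},e_{14}$, which share the vertex $a_1$, then it equals $$B(\{a_1,a_2,a_3,a_4\}\cup e_{23}\cup e_{24}\cup e_{34})=B(\{a_1\}\cup e_{23}\cup e_{24}\cup e_{34}).$$ The same formulas, with the indices permuted, hold for every other choice of the common face or vertex. -/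

import Mathlib

open Set Metric
open scoped RealInnerProductSpace Matrix

noncomputable section

namespace Meissner

/-- Euclidean three-space. -/
abbrev E3 : Type := EuclideanSpace ℝ (Fin 3)

/-- `ballInter X` is `B(X)`, the intersection of the closed unit balls centred at the points
of `X`. -/
def ballInter (X : Set E3) : Set E3 := ⋂ x ∈ X, closedBall x 1

/-- The plane `{x | ⟪u, x⟫ = c}` supports `K`, and `K` lies on the side `⟪u, x⟫ ≤ c` of it. -/
def IsSupportingPlane (K : Set E3) (u : E3) (c : ℝ) : Prop :=
  (∀ x ∈ K, ⟪u, x⟫ ≤ c) ∧ ∃ x ∈ K, ⟪u, x⟫ = c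

/-- `K` is a (nonempty) convex body of constant width one: any two parallel supporting planes
`{x | ⟪u, x⟫ = c}` and `{x | ⟪-u, x⟫ = c'}`, with `u` a unit vector and `K` between them, have
distance `c + c' = 1`. -/
def HasConstantWidth (K : Set E3) : Prop :=
  Convex ℝ K ∧ IsCompact K ∧ K.Nonempty ∧
    ∀ (u : E3) (c c' : ℝ), ‖u‖ = 1 →
      IsSupportingPlane K u c → IsSupportingPlane K (-u) c' → c + c' = 1

/-- The points `a 0, a 1, a 2, a 3` are the vertices of a regular tetrahedron of side one. -/
def IsUnitTetrahedron (a : Fin 4 → E3) : Prop := ∀ i j, i ≠ j → dist (a i) (a j) = 1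

/-- The Reuleaux tetrahedron with vertices `a`. -/
def reuleaux (a : Fin 4 → E3) : Set E3 := ballInter (range a)

/-- The face of the Reuleaux tetrahedron opposite to the vertex `a k`. -/
def face (a : Fin 4 → E3) (k : Fin 4) : Set E3 := sphere (a k) 1 ∩ reuleaux a

/-- The edge of the Reuleaux tetrahedron joining `a i` to `a j` (`i ≠ j`, endpoints included): the
intersection of the two faces opposite to the other two vertices. -/
def edge (a : Fin 4 → E3) (i j : Fin 4) : Set E3 := ⋂ k ∈ ({i, j}ᶜ : Set (Fin 4)), face a k

/-- The geodesic (minor arc of a great circle) from `p` to `q` in the unit sphere centred at `c`,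
for points `p`, `q` of that sphere that are not antipodal. -/
def geodesic (c p q : E3) : Set E3 :=
  {x | x ∈ sphere c 1 ∧ ∃ s t : ℝ, 0 ≤ s ∧ 0 ≤ t ∧ x - c = s • (p - c) + t • (q - c)}

/-- The cross product on `E3`. -/
def cross (u v : E3) : E3 := WithLp.toLp 2 (u.ofLp ⨯₃ v.ofLp)

/-- The rotation by the angle `θ` about the line through `p` with unit direction `u`
(Rodrigues' formula). -/
def axisRotation (p u : E3) (θ : ℝ) (x : E3) : E3 :=
  p + Real.cos θ • (x - p) + Real.sin θ • cross u (x - p) +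
    ((1 - Real.cos θ) * ⟪u, x - p⟫) • u

/-- The surface swept out by rotating the curve `γ` into the curve `γ'` about the line through `p`
and `q`, through the rotation angle `φ` of absolute value less than `π` that carries `γ` onto
`γ'`. -/
def sweptSurface (p q : E3) (γ γ' : Set E3) : Set E3 :=
  {y | ∃ φ ∈ Ioo (-Real.pi) Real.pi,
    axisRotation p (‖q - p‖⁻¹ • (q - p)) φ '' γ = γ' ∧
      ∃ θ ∈ uIcc 0 φ, y ∈ axisRotation p (‖q - p‖⁻¹ • (q - p)) θ '' γ}

/-- For `{i, j, k, l} = {0, 1, 2, 3}`: the region of the boundary of the Reuleaux tetrahedron that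
contains the (relatively open) edge joining `a i` to `a j` and is bounded by the geodesics from
`a i` to `a j` in the unit spheres centred at `a k` and `a l`. The bounding geodesics are not part
of the region. -/
def edgeRegion (a : Fin 4 → E3) (i j k l : Fin 4) : Set E3 :=
  ⋃ y ∈ edge a i j, connectedComponentIn
    (frontier (reuleaux a) \ (geodesic (a k) (a i) (a j) ∪ geodesic (a l) (a i) (a j))) y

/-- For `{i, j, k, l} = {0, 1, 2, 3}`: the piece of a spindle torus obtained by rotating the
geodesic from `a i` to `a j` in the unit sphere centred at `a k` into the one in the unit sphere
centred at `a l`, about the line through `a i` and `a j`. -/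
def spindlePiece (a : Fin 4 → E3) (i j k l : Fin 4) : Set E3 :=
  sweptSurface (a i) (a j) (geodesic (a k) (a i) (a j)) (geodesic (a l) (a i) (a j))

/-- `i, j, k, l` are distinct, and the edge joining `a i` to `a j` is one of the edges in `S`. -/
def IsLabelling (S : Set (Sym2 (Fin 4))) (i j k l : Fin 4) : Prop :=
  [i, j, k, l].Nodup ∧ s(i, j) ∈ S

/-- The surface obtained from the boundary of the Reuleaux tetrahedron by replacing, for every edge
in `S`, the region near that edge with the piece of a spindle torus. -/
def surgeredSurface (a : Fin 4 → E3) (S : Set (Sym2 (Fin 4))) : Set E3 :=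
  {x | x ∈ frontier (reuleaux a) ∧ ∀ i j k l, IsLabelling S i j k l → x ∉ edgeRegion a i j k l} ∪
    {x | ∃ i j k l, IsLabelling S i j k l ∧ x ∈ spindlePiece a i j k l}

/-- `M` is the convex body bounded by the surface that results from surgery near the edges
in `S`. -/
def IsSurgeredBody (a : Fin 4 → E3) (S : Set (Sym2 (Fin 4))) (M : Set E3) : Prop :=
  Convex ℝ M ∧ IsCompact M ∧ frontier M = surgeredSurface a S

/-- `M` is the Meissner tetrahedron made from the Reuleaux tetrahedron with vertices `a` by surgery
near the three edges that share the face opposite to `a k`. -/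
def IsMeissnerFace (a : Fin 4 → E3) (k : Fin 4) (M : Set E3) : Prop :=
  IsSurgeredBody a {e | k ∉ e} M

/-- `M` is the Meissner tetrahedron made from the Reuleaux tetrahedron with vertices `a` by surgery
near the three edges that share the vertex `a k`. -/
def IsMeissnerVertex (a : Fin 4 → E3) (k : Fin 4) (M : Set E3) : Prop :=
  IsSurgeredBody a {e | k ∈ e} M

/-- The union of the three edges that share the vertex `a k`. -/
def edgesAtVertex (a : Fin 4 → E3) (k : Fin 4) : Set E3 :=
  {x | ∃ j, j ≠ k ∧ x ∈ edge a k j}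

/-- The union of the three edges that share the face opposite to `a k`. -/
def edgesOfFace (a : Fin 4 → E3) (k : Fin 4) : Set E3 :=
  {x | ∃ i j, i ≠ j ∧ i ≠ k ∧ j ≠ k ∧ x ∈ edge a i j}

end Meissner

end

open Set Metric
open scoped RealInnerProductSpace Matrix

noncomputable section

namespace Meissner

/-! Let `S` be the set of edges near which surgery is done, and let `M` be the intersection of the
unit balls about the vertices and about all points of the edges opposite to those in `S`
(`ballCenters`). Everything reduces to two facts about `M`.

The frontier of `M` is the surgered surface (`frontier_ballInter_ballCenters`). The arc traced by
the centre of a rotating geodesic is the opposite edge, so a spindle piece is a union of unit arcs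
centred on that edge (`mem_spindlePiece`). The ball about a point of an edge restricts the Reuleaux
tetrahedron only inside the wedge at the opposite edge (`dist_edge_le`), and the frontier points in
that wedge form the removed region (`mem_edgeRegion`). Since a convex body is the closed convex hull
of its frontier, `M` is the only body with this frontier.

`M` equals the intersection of the unit balls about its own points, and this forces constant width
(`hasConstantWidth_of_eq_ballInter`). One inclusion holds because the centres belong to `M`. The
other says that `M` has diameter at most one, and there it suffices to bound distances from frontier
points. Each frontier point lies on a unit sphere about some `p`, in the spherical hull, seen from
`p`, of points that are themselves centres; `dist_le_of_mem_cone` then applies. Both inclusions need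
`S` to contain exactly one edge of each opposite pair. -/

/-! ### Intersections of unit balls. -/

theorem mem_ballInter {X : Set E3} {x : E3} : x ∈ ballInter X ↔ ∀ p ∈ X, dist x p ≤ 1 := by
  simp [ballInter]

theorem convex_ballInter (X : Set E3) : Convex ℝ (ballInter X) :=
  convex_iInter₂ fun x _ => convex_closedBall x 1

theorem isClosed_ballInter (X : Set E3) : IsClosed (ballInter X) :=
  isClosed_biInter fun _ _ => isClosed_closedBall

theorem isCompact_ballInter {X : Set E3} (hX : X.Nonempty) : IsCompact (ballInter X) := by
  obtain ⟨p, hp⟩ := hX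
  exact (isCompact_closedBall p 1).of_isClosed_subset (isClosed_ballInter X)
    (biInter_subset_of_mem hp)

theorem dist_lt_one_of_mem_interior_ballInter {X : Set E3} {x p : E3}
    (hx : x ∈ interior (ballInter X)) (hp : p ∈ X) : dist x p < 1 := by
  have h : x ∈ interior (closedBall p 1) := interior_mono (biInter_subset_of_mem hp) hx
  rwa [interior_closedBall p one_ne_zero, mem_ball] at h

theorem mem_interior_ballInter {X : Set E3} (hX : IsCompact X) {x : E3}
    (hx : ∀ p ∈ X, dist x p < 1) : x ∈ interior (ballInter X) := by
  rcases X.eq_empty_or_nonempty with rfl | hne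
  · simp [ballInter]
  obtain ⟨q, hq, hmax⟩ := hX.exists_isMaxOn hne (f := fun p => dist x p) (by fun_prop)
  refine mem_interior.2 ⟨ball x (1 - dist x q), fun y hy => mem_ballInter.2 fun p hp => ?_,
    isOpen_ball, mem_ball_self (by linarith [hx q hq])⟩
  have h1 : dist x p ≤ dist x q := hmax hp
  have h2 := dist_triangle y x p
  rw [mem_ball] at hy
  linarith

theorem mem_frontier_ballInter {X : Set E3} (hX : IsCompact X) {x : E3} :
    x ∈ frontier (ballInter X) ↔ x ∈ ballInter X ∧ ∃ p ∈ X, dist x p = 1 := by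
  rw [(isClosed_ballInter X).frontier_eq, mem_sdiff]
  refine and_congr_right fun hx => ⟨fun h => ?_, fun ⟨p, hp, h1⟩ h => ?_⟩
  · by_contra! hne
    exact h (mem_interior_ballInter hX fun p hp =>
      lt_of_le_of_ne (mem_ballInter.1 hx p hp) (hne p hp))
  · exact (dist_lt_one_of_mem_interior_ballInter h hp).ne h1

/-! ### Convex bodies, ball convexity and constant width. -/

/-- Krein–Milman, since an interior point is the midpoint of a short segment in `K` and so is not
extreme. This gives uniqueness of the body with a prescribed boundary. -/
theorem closure_convexHull_frontier {K : Set E3} (hc : Convex ℝ K) (hK : IsCompact K) :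
    closure (convexHull ℝ (frontier K)) = K := by
  have hfr : frontier K ⊆ K := hK.isClosed.frontier_subset
  apply subset_antisymm
  · exact closure_minimal (convexHull_min hfr hc) hK.isClosed
  · conv_lhs => rw [← closure_convexHull_extremePoints hK hc]
    refine closure_mono (convexHull_mono fun x hx => ?_)
    rw [hK.isClosed.frontier_eq]
    refine ⟨hx.1, fun hint => ?_⟩
    obtain ⟨ε, hε, hball⟩ := Metric.mem_nhds_iff.1 (mem_interior_iff_mem_nhds.1 hint)
    obtain ⟨v, hv⟩ := exists_ne (0 : E3)
    have hv' : 0 < ‖v‖ := norm_pos_iff.2 hv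
    set w : E3 := (ε / 2 / ‖v‖) • v with hw
    have hwn : ‖w‖ = ε / 2 := by
      rw [hw, norm_smul, Real.norm_of_nonneg (by positivity)]
      field_simp
    have h1 : x + w ∈ K := hball (by simp [hwn]; linarith)
    have h2 : x - w ∈ K := hball (by simp [hwn]; linarith)
    have := hx.2 h1 h2 ⟨1/2, 1/2, by norm_num, by norm_num, by norm_num, by module⟩
    have h0 : w = 0 := by simpa using this
    rw [h0, norm_zero] at hwn
    linarith

/-- If `K` lies in the unit ball about every one of its boundary points, its diameter is at most
one. -/
theorem subset_ballInter_self {K : Set E3} (hc : Convex ℝ K) (hK : IsCompact K)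
    (h : ∀ x ∈ frontier K, ∀ z ∈ K, dist z x ≤ 1) : K ⊆ ballInter K := by
  intro y hy
  refine mem_ballInter.2 fun z hz => ?_
  rw [← closure_convexHull_frontier hc hK] at hy
  have : frontier K ⊆ closedBall z 1 := fun x hx => by
    rw [mem_closedBall, dist_comm]; exact h x hx z hz
  exact closure_minimal (convexHull_min this (convex_closedBall z 1)) isClosed_closedBall hy

/-- A body that is ball convex lies in the unit ball that touches a supporting plane from inside
at a point of contact. -/
theorem sub_mem_ballInter {K : Set E3} (hK : K = ballInter (ballInter K)) {u x : E3}
    (hu : ‖u‖ = 1) (hx : x ∈ K) (hsup : ∀ z ∈ K, ⟪u, z⟫ ≤ ⟪u, x⟫) : x - u ∈ ballInter K := by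
  refine mem_ballInter.2 fun z hz => ?_
  by_contra! hlt
  set v := z - x with hv
  have hvu : 0 < ‖v‖ ^ 2 + 2 * ⟪u, v⟫ := by
    have e : dist (x - u) z = ‖v + u‖ := by
      rw [dist_comm, dist_eq_norm]; congr 1; rw [hv]; abel
    have e2 := norm_add_sq_real v u
    rw [real_inner_comm, hu] at e2
    rw [e] at hlt
    nlinarith
  -- Uniform convexity of the ball: `x + ε • v` lies at depth at least `r` in every unit ball
  -- containing `x` and `z`, so moving it by `r` along `u` stays in `K`. The supporting plane at `x`
  -- limits that move.
  have key : ∀ ε : ℝ, 0 < ε → ε < 1 → ε * ⟪u, v⟫ + ε * (1 - ε) * ‖v‖ ^ 2 / 2 ≤ 0 := by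
    intro ε h0 h1
    set r := ε * (1 - ε) * ‖v‖ ^ 2 / 2 with hr
    have hr0 : 0 ≤ r := by
      have : 0 ≤ 1 - ε := by linarith
      positivity
    have hmem : x + ε • v + r • u ∈ K := by
      rw [hK]
      refine mem_ballInter.2 fun q hq => ?_
      have hxq : ‖x - q‖ ≤ 1 := by
        have := mem_ballInter.1 hq x hx; rwa [dist_comm, dist_eq_norm] at this
      have hzq : ‖v + (x - q)‖ ≤ 1 := by
        have := mem_ballInter.1 hq z hz
        rw [dist_comm, dist_eq_norm] at this
        rwa [show v + (x - q) = z - q by rw [hv]; abel]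
      have e3 := norm_add_sq_real v (x - q)
      have e4 : ‖ε • v + (x - q)‖ ^ 2 = ε ^ 2 * ‖v‖ ^ 2 + 2 * (ε * ⟪v, x - q⟫) + ‖x - q‖ ^ 2 := by
        rw [norm_add_sq_real, norm_smul, real_inner_smul_left, mul_pow, Real.norm_eq_abs, sq_abs]
      have hxq2 : ‖x - q‖ ^ 2 ≤ 1 := by nlinarith [norm_nonneg (x - q)]
      have hzq2 : ‖v + (x - q)‖ ^ 2 ≤ 1 := by nlinarith [norm_nonneg (v + (x - q))]
      have h5 : ‖ε • v + (x - q)‖ ^ 2 ≤ 1 - 2 * r := by nlinarith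
      have h6 : ‖ε • v + (x - q)‖ ≤ 1 - r := by
        have h7 : 0 ≤ 1 - 2 * r := le_trans (sq_nonneg _) h5
        exact abs_le_of_sq_le_sq' (by nlinarith) (by linarith) |>.2
      rw [dist_eq_norm, show x + ε • v + r • u - q = (ε • v + (x - q)) + r • u by abel]
      refine (norm_add_le _ _).trans ?_
      rw [norm_smul, hu, Real.norm_of_nonneg hr0]
      linarith
    have := hsup _ hmem
    rw [inner_add_right, inner_add_right, real_inner_smul_right, real_inner_smul_right,
      real_inner_self_eq_norm_sq, hu] at this
    linarith
  have hvb : 0 < ‖v‖ ^ 2 := by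
    by_contra! h
    have h0 : ‖v‖ ^ 2 = 0 := le_antisymm h (sq_nonneg _)
    have : v = 0 := by simpa using h0
    simp [this] at hvu
  -- Divided by `ε / 2`, `key` reads `D - ε * ‖v‖ ^ 2 ≤ 0`, which fails for small `ε` because `D >
  -- 0`. The value chosen below stays under both `1` and `D / ‖v‖ ^ 2`.
  set D := ‖v‖ ^ 2 + 2 * ⟪u, v⟫ with hD
  have hpos : 0 < D / (2 * (‖v‖ ^ 2 + D)) := by positivity
  have hlt1 : D / (2 * (‖v‖ ^ 2 + D)) < 1 := by
    rw [div_lt_one (by positivity)]; linarith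
  have h := key _ hpos hlt1
  set ε := D / (2 * (‖v‖ ^ 2 + D)) with hε
  have hεv : ε * (2 * (‖v‖ ^ 2 + D)) = D := by rw [hε]; field_simp
  have h9 : ε * (D - ε * ‖v‖ ^ 2) ≤ 0 := by nlinarith
  have h10 : 0 < D - ε * ‖v‖ ^ 2 := by nlinarith
  nlinarith [mul_pos hpos h10]

/-- The contact points of two parallel supporting planes are at distance at most one, which bounds
the width above. Moving a contact point by one along the inner normal stays in `ballInter K = K`,
which bounds it below. -/
theorem hasConstantWidth_of_eq_ballInter {K : Set E3} (hne : K.Nonempty) (hK : K = ballInter K) :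
    HasConstantWidth K := by
  refine ⟨hK ▸ convex_ballInter K, hK ▸ isCompact_ballInter hne, hne, ?_⟩
  rintro u c c' hu ⟨hs, x, hx, rfl⟩ ⟨hs', y, hy, rfl⟩
  apply le_antisymm
  · have h1 : dist x y ≤ 1 := mem_ballInter.1 (hK ▸ hx) y hy
    have h2 := real_inner_le_norm u (x - y)
    rw [hu, one_mul, ← dist_eq_norm, inner_sub_right] at h2
    rw [inner_neg_left]
    linarith
  · have h1 := sub_mem_ballInter (by rw [← hK]; exact hK) hu hx hs
    rw [← hK] at h1
    have h2 := hs' _ h1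
    rw [inner_neg_left, inner_sub_right, real_inner_self_eq_norm_sq, hu] at h2
    linarith

/-! ### Spherical hulls seen from the centre of a sphere. -/

/-- A point in the spherical convex hull of `t₁`, `t₂`, `t₃`, seen from `p`, is at least as close
to the points of `B({t₁, t₂, t₃})` as to `p`. -/
theorem dist_le_of_mem_cone {p x t₁ t₂ t₃ z : E3} {α β γ : ℝ} (hα : 0 ≤ α) (hβ : 0 ≤ β)
    (hγ : 0 ≤ γ) (hsum : 1 ≤ α + β + γ)
    (hx : x - p = α • (t₁ - p) + β • (t₂ - p) + γ • (t₃ - p))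
    (h₁ : dist t₁ p = 1) (h₂ : dist t₂ p = 1) (h₃ : dist t₃ p = 1)
    (hz₁ : dist z t₁ ≤ 1) (hz₂ : dist z t₂ ≤ 1) (hz₃ : dist z t₃ ≤ 1) :
    dist z x ≤ dist x p := by
  -- Closeness to `t` becomes an inequality linear in `t - p`, hence stable under nonnegative
  -- combinations of total weight at least one.
  have aux : ∀ t : E3, dist t p = 1 → dist z t ≤ 1 → ‖z - p‖ ^ 2 / 2 ≤ ⟪z - p, t - p⟫ := by
    intro t h hz
    rw [dist_eq_norm] at h hz
    have e := norm_sub_sq_real (z - p) (t - p)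
    rw [h, show z - p - (t - p) = z - t by abel] at e
    nlinarith [norm_nonneg (z - t)]
  have h1 := aux t₁ h₁ hz₁
  have h2 := aux t₂ h₂ hz₂
  have h3 := aux t₃ h₃ hz₃
  have e : ⟪z - p, x - p⟫ = α * ⟪z - p, t₁ - p⟫ + β * ⟪z - p, t₂ - p⟫ + γ * ⟪z - p, t₃ - p⟫ := by
    rw [hx, inner_add_right, inner_add_right, real_inner_smul_right, real_inner_smul_right,
      real_inner_smul_right]
  have e2 := norm_sub_sq_real (z - p) (x - p)
  rw [show z - p - (x - p) = z - x by abel] at e2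
  rw [dist_eq_norm, dist_eq_norm]
  have hz := sq_nonneg ‖z - p‖
  refine abs_le_of_sq_le_sq' ?_ (norm_nonneg _) |>.2
  nlinarith [mul_le_mul_of_nonneg_left h1 hα, mul_le_mul_of_nonneg_left h2 hβ,
    mul_le_mul_of_nonneg_left h3 hγ]

theorem one_le_of_dist_eq_one {p x t₁ t₂ t₃ : E3} {α β γ : ℝ} (hα : 0 ≤ α) (hβ : 0 ≤ β)
    (hγ : 0 ≤ γ) (hx : x - p = α • (t₁ - p) + β • (t₂ - p) + γ • (t₃ - p))
    (h₁ : dist t₁ p = 1) (h₂ : dist t₂ p = 1) (h₃ : dist t₃ p = 1) (hd : dist x p = 1) :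
    1 ≤ α + β + γ := by
  rw [dist_eq_norm] at *
  rw [← hd, hx]
  refine (norm_add₃_le).trans ?_
  simp [norm_smul, abs_of_nonneg, *]

/-! ### Barycentric coordinates of the regular tetrahedron. -/

/-- The centroid of the points `a 0, a 1, a 2, a 3`. -/
def center (a : Fin 4 → E3) : E3 := (4 : ℝ)⁻¹ • ∑ i, a i

/-- The linear part of the barycentric coordinate `bary a i`. -/
def lin (a : Fin 4 → E3) (i : Fin 4) (v : E3) : ℝ := 2 * ⟪v, a i - center a⟫

/-- The barycentric coordinate that belongs to the vertex `a i` of the unit tetrahedron `a`. -/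
def bary (a : Fin 4 → E3) (i : Fin 4) (x : E3) : ℝ := 1 / 4 + lin a i (x - center a)

theorem sum_eq_of_nodup {i j k l : Fin 4} (h : [i, j, k, l].Nodup) {M : Type*} [AddCommMonoid M]
    (f : Fin 4 → M) : ∑ n, f n = f i + f j + f k + f l := by
  have hu : (Finset.univ : Finset (Fin 4)) = {i, j, k, l} := by
    revert h; revert i j k l; decide
  simp only [List.nodup_cons, List.mem_cons, not_or, List.not_mem_nil, not_false_eq_true,
    List.nodup_nil, and_true] at h
  obtain ⟨⟨h1, h2, h3⟩, ⟨h4, h5⟩, h6⟩ := h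
  rw [hu, Finset.sum_insert (by simp [*]), Finset.sum_insert (by simp [*]),
    Finset.sum_insert (by simp [*]), Finset.sum_singleton]
  simp only [add_assoc]

theorem eq_of_nodup {i j k l : Fin 4} (h : [i, j, k, l].Nodup) (n : Fin 4) :
    n = i ∨ n = j ∨ n = k ∨ n = l := by
  revert h; revert i j k l n; decide

theorem sum_sub_center (a : Fin 4 → E3) : ∑ i, (a i - center a) = 0 := by
  simp only [Finset.sum_sub_distrib, center, Finset.sum_const, Finset.card_univ, Fintype.card_fin]
  rw [← Nat.cast_smul_eq_nsmul ℝ, smul_smul]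
  norm_num

theorem lin_add (a : Fin 4 → E3) (i : Fin 4) (v w : E3) : lin a i (v + w) = lin a i v + lin a i w := by
  simp only [lin, inner_add_left]; ring

theorem lin_sub (a : Fin 4 → E3) (i : Fin 4) (v w : E3) : lin a i (v - w) = lin a i v - lin a i w := by
  simp only [lin, inner_sub_left]; ring

theorem lin_smul (a : Fin 4 → E3) (i : Fin 4) (c : ℝ) (v : E3) : lin a i (c • v) = c * lin a i v := by
  simp only [lin, real_inner_smul_left]; ring

theorem lin_vsub (a : Fin 4 → E3) (i : Fin 4) (x y : E3) :
    lin a i (x - y) = bary a i x - bary a i y := by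
  simp only [bary, lin_sub]; ring

theorem bary_add (a : Fin 4 → E3) (i : Fin 4) (x v : E3) :
    bary a i (x + v) = bary a i x + lin a i v := by
  rw [show x + v = v + x by abel, ← sub_eq_iff_eq_add', ← lin_vsub, add_sub_cancel_right]

@[fun_prop]
theorem continuous_bary (a : Fin 4 → E3) (i : Fin 4) : Continuous (bary a i) := by
  unfold bary lin; fun_prop

theorem sum_lin (a : Fin 4 → E3) (v : E3) : ∑ i, lin a i v = 0 := by
  simp only [lin, ← Finset.mul_sum, ← inner_sum, sum_sub_center, inner_zero_right, mul_zero]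

theorem sum_bary (a : Fin 4 → E3) (x : E3) : ∑ i, bary a i x = 1 := by
  simp only [bary, Finset.sum_add_distrib, sum_lin]; norm_num

/-- The side lengths express each mixed product through two norms; the centred vertices sum to zero,
and the resulting linear system fixes all products. -/
theorem inner_sub_center {a : Fin 4 → E3} (ha : IsUnitTetrahedron a) (i j : Fin 4) :
    ⟪a i - center a, a j - center a⟫ = if i = j then 3 / 8 else -1 / 8 := by
  set b : Fin 4 → E3 := fun i => a i - center a with hb
  have hd : ∀ i j, i ≠ j → 2 * ⟪b i, b j⟫ = ⟪b i, b i⟫ + ⟪b j, b j⟫ - 1 := by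
    intro i j hij
    have h := ha i j hij
    rw [dist_eq_norm, show a i - a j = b i - b j by simp [hb]] at h
    have e := norm_sub_sq_real (b i) (b j)
    rw [h] at e
    rw [real_inner_self_eq_norm_sq, real_inner_self_eq_norm_sq]
    linarith
  have hs : ∀ i, ⟪b i, b 0⟫ + ⟪b i, b 1⟫ + ⟪b i, b 2⟫ + ⟪b i, b 3⟫ = 0 := by
    intro i
    have := sum_sub_center a
    have h2 : ⟪b i, ∑ j, b j⟫ = 0 := by rw [this, inner_zero_right]
    rwa [inner_sum, Fin.sum_univ_four] at h2
  have h0 := hs 0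
  have h1 := hs 1
  have h2 := hs 2
  have h3 := hs 3
  have hc : ∀ i j, ⟪b i, b j⟫ = ⟪b j, b i⟫ := fun i j => real_inner_comm _ _
  rw [hc 1 0] at h1
  rw [hc 2 0, hc 2 1] at h2
  rw [hc 3 0, hc 3 1, hc 3 2] at h3
  have e01 := hd 0 1 (by decide)
  have e02 := hd 0 2 (by decide)
  have e03 := hd 0 3 (by decide)
  have e12 := hd 1 2 (by decide)
  have e13 := hd 1 3 (by decide)
  have e23 := hd 2 3 (by decide)
  have N : ∀ i, ⟪b i, b i⟫ = 3 / 8 := by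
    intro i
    fin_cases i <;> simp only [Fin.zero_eta, Fin.mk_one, Fin.reduceFinMk] <;> linarith
  change ⟪b i, b j⟫ = _
  split_ifs with h
  · rw [h, N]
  · have := hd i j h
    rw [N, N] at this
    linarith

theorem bary_vertex {a : Fin 4 → E3} (ha : IsUnitTetrahedron a)
    (i j : Fin 4) : bary a i (a j) = if j = i then 1 else 0 := by
  rw [bary, lin, inner_sub_center ha]
  split_ifs <;> norm_num

theorem lin_vertex {a : Fin 4 → E3} (ha : IsUnitTetrahedron a)
    (i j : Fin 4) : lin a i (a j - center a) = if j = i then 3 / 4 else -1 / 4 := by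
  rw [lin, inner_sub_center ha]
  split_ifs <;> norm_num

theorem eq_zero_of_inner_eq_zero {a : Fin 4 → E3} (ha : IsUnitTetrahedron a)
    {r : E3} (h : ∀ j, ⟪r, a j - center a⟫ = 0) : r = 0 := by
  have hli : LinearIndependent ℝ (fun i : Fin 3 => a i.castSucc - center a) := by
    rw [Fintype.linearIndependent_iff]
    intro c hc j
    -- Pairing with the difference of two centred vertices isolates half of the coefficient `c j`.
    have h1 : ⟪∑ i, c i • (a (Fin.castSucc i) - center a),
        (a (Fin.castSucc j) - center a) - (a 3 - center a)⟫ = 0 := by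
      rw [hc, inner_zero_left]
    rw [sum_inner] at h1
    simp only [real_inner_smul_left, inner_sub_right (𝕜 := ℝ) _ (a (Fin.castSucc j) - center a),
      inner_sub_center ha, Fin.sum_univ_three] at h1
    fin_cases j <;> simp at h1 <;> (dsimp only [Fin.zero_eta, Fin.mk_one, Fin.reduceFinMk]; linarith)
  have hspan := hli.span_eq_top_of_card_eq_finrank (by simp)
  have hr : r ∈ (Submodule.span ℝ (Set.range fun i : Fin 3 => a i.castSucc - center a))ᗮ := by
    rw [Submodule.mem_orthogonal']
    intro u hu
    induction hu using Submodule.span_induction with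
    | mem x hx => obtain ⟨i, rfl⟩ := hx; exact h _
    | zero => simp
    | add x y _ _ hx hy => rw [inner_add_right, hx, hy, add_zero]
    | smul c x _ hx => rw [real_inner_smul_right, hx, mul_zero]
  rw [hspan, Submodule.top_orthogonal_eq_bot] at hr
  simpa using hr

/-- The Gram matrix of the centred vertices is half the identity minus a multiple of the all-ones
matrix. The latter kills the vector of values `lin a i v`, whose sum is zero; the factor `2` in
`lin` cancels the half. -/
theorem eq_sum_lin {a : Fin 4 → E3} (ha : IsUnitTetrahedron a)
    (v : E3) : v = ∑ i, lin a i v • (a i - center a) := by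
  rw [← sub_eq_zero]
  apply eq_zero_of_inner_eq_zero ha
  intro j
  have hs := sum_lin a v
  rw [Fin.sum_univ_four] at hs
  have hl : ⟪v, a j - center a⟫ = lin a j v / 2 := by rw [lin]; ring
  rw [inner_sub_left, sum_inner, hl]
  simp only [real_inner_smul_left, inner_sub_center ha, Fin.sum_univ_four]
  fin_cases j <;> simp <;> linarith

theorem inner_eq_lin {a : Fin 4 → E3} (ha : IsUnitTetrahedron a)
    (v w : E3) : ⟪v, w⟫ = (∑ i, lin a i v * lin a i w) / 2 := by
  conv_lhs => rw [eq_sum_lin ha w, inner_sum]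
  rw [Finset.sum_div]
  refine Finset.sum_congr rfl fun i _ => ?_
  rw [real_inner_smul_right, lin, lin]; ring

theorem dist_sq_eq {a : Fin 4 → E3} (ha : IsUnitTetrahedron a)
    (x y : E3) : dist x y ^ 2 = (∑ i, (bary a i x - bary a i y) ^ 2) / 2 := by
  rw [dist_eq_norm, ← real_inner_self_eq_norm_sq, inner_eq_lin ha]
  simp only [lin_vsub, sq]

theorem eq_of_bary_eq {a : Fin 4 → E3} (ha : IsUnitTetrahedron a)
    {x y : E3} (h : ∀ i, bary a i x = bary a i y) : x = y := by
  have := dist_sq_eq ha x y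
  simpa [h] using this

theorem eq_of_lin_eq {a : Fin 4 → E3} (ha : IsUnitTetrahedron a)
    {v w : E3} (h : ∀ i, lin a i v = lin a i w) : v = w := by
  rw [eq_sum_lin ha v, eq_sum_lin ha w]; simp only [h]

theorem bary_sum {a : Fin 4 → E3} (ha : IsUnitTetrahedron a)
    (c : Fin 4 → ℝ) (hc : ∑ i, c i = 1) (i : Fin 4) :
    bary a i (∑ j, c j • a j) = c i := by
  rw [Fin.sum_univ_four] at hc
  have e : ∑ j, c j • a j = center a + ∑ j, c j • (a j - center a) := by
    simp only [Fin.sum_univ_four]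
    have : (c 0 + c 1 + c 2 + c 3 - 1) • center a = 0 := by rw [hc, sub_self, zero_smul]
    rw [← sub_eq_zero, ← this]
    module
  rw [e, bary_add, bary, sub_self]
  simp only [Fin.sum_univ_four, lin_add, lin_smul, lin_vertex ha]
  rw [show lin a i 0 = 0 by simp [lin]]
  fin_cases i <;> simp <;> linarith

theorem dist_vertex_sq {a : Fin 4 → E3} (ha : IsUnitTetrahedron a) (x : E3) (n : Fin 4) :
    dist x (a n) ^ 2 = (∑ i, bary a i x ^ 2 - 2 * bary a n x + 1) / 2 := by
  rw [dist_sq_eq ha]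
  simp only [Fin.sum_univ_four, bary_vertex ha]
  fin_cases n <;> simp <;> ring

theorem dist_vertex_le_iff {a : Fin 4 → E3} (ha : IsUnitTetrahedron a) (x : E3) (n : Fin 4) :
    dist x (a n) ≤ 1 ↔ ∑ i, bary a i x ^ 2 ≤ 1 + 2 * bary a n x := by
  rw [← sq_le_one_iff₀ dist_nonneg, dist_vertex_sq ha]
  constructor <;> intro h <;> linarith

theorem dist_vertex_eq_iff {a : Fin 4 → E3} (ha : IsUnitTetrahedron a) (x : E3) (n : Fin 4) :
    dist x (a n) = 1 ↔ ∑ i, bary a i x ^ 2 = 1 + 2 * bary a n x := by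
  rw [← pow_eq_one_iff_of_nonneg dist_nonneg two_ne_zero, dist_vertex_sq ha]
  constructor <;> intro h <;> linarith

theorem mem_reuleaux {a : Fin 4 → E3} {x : E3} : x ∈ reuleaux a ↔ ∀ n, dist x (a n) ≤ 1 := by
  simp [reuleaux, mem_ballInter]

theorem mem_frontier_reuleaux {a : Fin 4 → E3} {x : E3} :
    x ∈ frontier (reuleaux a) ↔ x ∈ reuleaux a ∧ ∃ n, dist x (a n) = 1 := by
  rw [reuleaux, mem_frontier_ballInter (finite_range a).isCompact, exists_range_iff]

/-! ### Edges, and distances to their points. -/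

theorem mem_edge {a : Fin 4 → E3} {i j k l : Fin 4} (h : [i, j, k, l].Nodup) {x : E3} :
    x ∈ edge a k l ↔ x ∈ reuleaux a ∧ dist x (a i) = 1 ∧ dist x (a j) = 1 := by
  have : ({k, l}ᶜ : Set (Fin 4)) = {i, j} := by
    ext n
    simp only [mem_compl_iff, mem_insert_iff, mem_singleton_iff]
    revert h; revert i j k l n; decide
  rw [edge, this]
  simp only [mem_insert_iff, mem_singleton_iff, iInter_iInter_eq_or_left, iInter_iInter_eq_left,
    face, mem_inter_iff, mem_sphere]
  tauto

/-- The edge joining `a k` to `a l` in barycentric coordinates. -/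
theorem mem_edge_iff {a : Fin 4 → E3} (ha : IsUnitTetrahedron a)
    {i j k l : Fin 4} (h : [i, j, k, l].Nodup) {x : E3} :
    x ∈ edge a k l ↔ bary a i x = bary a j x ∧ 0 ≤ bary a k x ∧ 0 ≤ bary a l x ∧
      3 * bary a k x ^ 2 + 3 * bary a l x ^ 2 + 2 * bary a k x * bary a l x = 3 := by
  have hs := sum_bary a x
  rw [sum_eq_of_nodup h] at hs
  rw [mem_edge h, mem_reuleaux]
  simp only [dist_vertex_le_iff ha, dist_vertex_eq_iff ha, sum_eq_of_nodup h]
  set p := bary a i x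
  set q := bary a j x
  set s := bary a k x
  set t := bary a l x
  constructor
  · rintro ⟨hr, h1, h2⟩
    have hpq : p = q := by linarith
    have hp : p = (1 - s - t) / 2 := by linarith
    have hk := hr k
    have hl := hr l
    have hq : 3 * s ^ 2 + 3 * t ^ 2 + 2 * s * t = 3 := by
      rw [← hpq, hp] at h1; linarith
    have h3 : 1 ≤ 3 * s + t := by linarith
    have h4 : 1 ≤ s + 3 * t := by linarith
    refine ⟨hpq, ?_, ?_, hq⟩
    · by_contra! hneg
      nlinarith
    · by_contra! hneg
      nlinarith
  · rintro ⟨hpq, h1, h2, hq⟩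
    have hp : p = (1 - s - t) / 2 := by linarith
    have h3 : 1 ≤ s + t := by nlinarith
    refine ⟨fun n => ?_, ?_, ?_⟩
    · rcases eq_of_nodup h n with rfl | rfl | rfl | rfl
      · change _ ≤ 1 + 2 * p
        rw [← hpq, hp]; linarith
      · change _ ≤ 1 + 2 * q
        rw [← hpq, hp]; linarith
      · change _ ≤ 1 + 2 * s
        rw [← hpq, hp]; linarith
      · change _ ≤ 1 + 2 * t
        rw [← hpq, hp]; linarith
    · rw [← hpq, hp]; linarith
    · rw [← hpq, hp]; linarith

/-- The quadratic relation on the edge absorbs all squares of the coordinates of `p`. For fixed `x`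
the squared distance is thus affine in the `k` and `l` coordinates of `p`, which makes comparison
with the end points a sign question. -/
theorem dist_edge_sq {a : Fin 4 → E3} (ha : IsUnitTetrahedron a)
    {i j k l : Fin 4} (h : [i, j, k, l].Nodup) {p : E3} (hp : p ∈ edge a k l)
    (x : E3) : dist x p ^ 2 = (∑ n, bary a n x ^ 2 + 1
      - (3 * bary a k p + bary a l p - 1) * bary a k x
      - (bary a k p + 3 * bary a l p - 1) * bary a l x) / 2 := by
  obtain ⟨h1, -, -, h4⟩ := (mem_edge_iff ha h).1 hp
  have hs := sum_bary a x
  have hs' := sum_bary a p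
  rw [dist_sq_eq ha]
  rw [sum_eq_of_nodup h] at *
  have h5 : bary a i p = (1 - bary a k p - bary a l p) / 2 := by linarith
  rw [← h1, h5, sum_eq_of_nodup h]
  have h6 : bary a i x = 1 - bary a j x - bary a k x - bary a l x := by linarith
  rw [h6]
  linear_combination (1 / 4) * h4

theorem one_le_add_of_mem_edge {a : Fin 4 → E3} (ha : IsUnitTetrahedron a)
    {i j k l : Fin 4} (h : [i, j, k, l].Nodup) {p : E3}
    (hp : p ∈ edge a k l) : 1 ≤ bary a k p + bary a l p ∧
      bary a k p + 3 * bary a l p ≤ 3 ∧ 3 * bary a k p + bary a l p ≤ 3 := by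
  obtain ⟨-, h2, h3, h4⟩ := (mem_edge_iff ha h).1 hp
  refine ⟨by nlinarith, ?_, ?_⟩
  · nlinarith [sq_nonneg (bary a k p), sq_nonneg (bary a l p - 1)]
  · nlinarith [sq_nonneg (bary a l p), sq_nonneg (bary a k p - 1)]

/-- Outside the wedge opposite to the edge from `a k` to `a l`, the points of this edge are not
farther away than the farther one of its ends. -/
theorem dist_edge_le {a : Fin 4 → E3} (ha : IsUnitTetrahedron a)
    {i j k l : Fin 4} (h : [i, j, k, l].Nodup) {p x : E3} (hp : p ∈ edge a k l)
    (hx : ¬ (bary a k x < 0 ∧ bary a l x < 0)) :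
    dist x p ≤ dist x (a k) ∨ dist x p ≤ dist x (a l) := by
  obtain ⟨-, h2, h3, h4⟩ := (mem_edge_iff ha h).1 hp
  obtain ⟨h5, h6, h7⟩ := one_le_add_of_mem_edge ha h hp
  have e := dist_edge_sq ha h hp x
  have ek := dist_vertex_sq ha x k
  have el := dist_vertex_sq ha x l
  -- The farther end is the one with the smaller coordinate. If it is `a k`, and `s`, `t` are the
  -- `k` and `l` coordinates of `p`, then twice the gain in squared distance is `(3 * s + t - 3) *
  -- bary a k x + (s + 3 * t - 1) * bary a l x`.
  rcases le_total (bary a k x) (bary a l x) with hle | hle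
  · left
    have h0 : 0 ≤ bary a l x := by
      by_contra! hn; exact hx ⟨by linarith, hn⟩
    refine abs_le_of_sq_le_sq' ?_ dist_nonneg |>.2
    rw [e, ek]
    rcases le_total 0 (bary a k x) with hk | hk
    · nlinarith [mul_nonneg (show 0 ≤ bary a k p + 3 * bary a l p - 1 by linarith) (sub_nonneg.2 hle)]
    · nlinarith [mul_nonneg (show 0 ≤ bary a k p + 3 * bary a l p - 1 by linarith) h0,
        mul_nonneg (show 0 ≤ 3 - 3 * bary a k p - bary a l p by linarith) (neg_nonneg.2 hk)]
  · right
    have h0 : 0 ≤ bary a k x := by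
      by_contra! hn; exact hx ⟨hn, by linarith⟩
    refine abs_le_of_sq_le_sq' ?_ dist_nonneg |>.2
    rw [e, el]
    rcases le_total 0 (bary a l x) with hk | hk
    · nlinarith [mul_nonneg (show 0 ≤ 3 * bary a k p + bary a l p - 1 by linarith) (sub_nonneg.2 hle)]
    · nlinarith [mul_nonneg (show 0 ≤ 3 * bary a k p + bary a l p - 1 by linarith) h0,
        mul_nonneg (show 0 ≤ 3 - bary a k p - 3 * bary a l p by linarith) (neg_nonneg.2 hk)]

/-! ### Cross products and rotations about an axis. -/

theorem inner_eq_coord (v w : E3) : ⟪v, w⟫ = v 0 * w 0 + v 1 * w 1 + v 2 * w 2 := by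
  simp [PiLp.inner_apply, Fin.sum_univ_three, mul_comm]

theorem cross_coord (u v : E3) : cross u v = !₂[u 1 * v 2 - u 2 * v 1, u 2 * v 0 - u 0 * v 2,
    u 0 * v 1 - u 1 * v 0] := by
  simp [cross, cross_apply]

theorem cross_add (u v w : E3) : cross u (v + w) = cross u v + cross u w := by
  simp [cross]

theorem cross_sub (u v w : E3) : cross u (v - w) = cross u v - cross u w := by
  simp [cross]

theorem cross_smul (u v : E3) (c : ℝ) : cross u (c • v) = c • cross u v := by
  simp [cross]

theorem cross_self (u : E3) : cross u u = 0 := by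
  simp [cross]

theorem inner_cross_left (u v : E3) : ⟪u, cross u v⟫ = 0 := by
  rw [inner_eq_coord, cross_coord]; simp; ring

theorem inner_cross_right (u v : E3) : ⟪v, cross u v⟫ = 0 := by
  rw [inner_eq_coord, cross_coord]; simp; ring

theorem inner_cross_cross (u v : E3) :
    ⟪cross u v, cross u v⟫ = ⟪u, u⟫ * ⟪v, v⟫ - ⟪u, v⟫ ^ 2 := by
  simp only [inner_eq_coord, cross_coord]; simp; ring

theorem smul_eq_cross_combination (u v w : E3) :
    ⟪cross u v, cross u v⟫ • w = ⟪cross u v, w⟫ • cross u v +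
      (⟪v, v⟫ * ⟪u, w⟫ - ⟪u, v⟫ * ⟪v, w⟫) • u + (⟪u, u⟫ * ⟪v, w⟫ - ⟪u, v⟫ * ⟪u, w⟫) • v := by
  ext n
  simp only [inner_eq_coord, cross_coord]
  fin_cases n <;> simp <;> ring

/-- Rotations are affine, so they preserve the coefficients that parametrize a geodesic. -/
theorem axisRotation_combination (p u : E3) (θ s t : ℝ) (c x y : E3) :
    axisRotation p u θ (c + s • (x - c) + t • (y - c)) = axisRotation p u θ c +
      s • (axisRotation p u θ x - axisRotation p u θ c) +
      t • (axisRotation p u θ y - axisRotation p u θ c) := by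
  have e : c + s • (x - c) + t • (y - c) - p =
      (c - p) + s • ((x - p) - (c - p)) + t • ((y - p) - (c - p)) := by module
  simp only [axisRotation]
  rw [e]
  simp only [cross_add, cross_sub, cross_smul, inner_add_right, inner_sub_right,
    real_inner_smul_right]
  module

theorem axisRotation_base (p u : E3) (θ : ℝ) : axisRotation p u θ p = p := by
  have : cross u 0 = 0 := by simpa using cross_smul u 0 0
  simp [axisRotation, this]

theorem axisRotation_axis {p u : E3} (hu : ‖u‖ = 1) (θ : ℝ) :
    axisRotation p u θ (p + u) = p + u := by
  simp only [axisRotation, add_sub_cancel_left, cross_self, real_inner_self_eq_norm_sq, hu]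
  module

/-! ### Geodesics over a common axis and the spindle torus. -/

/-- The triangle is equilateral, so `p - c` and `q - c` have inner product `1 / 2`; this turns the
sphere condition into the quadratic relation. -/
theorem mem_geodesic {c p q : E3} (hp : dist c p = 1) (hq : dist c q = 1) (hpq : dist p q = 1)
    {x : E3} : x ∈ geodesic c p q ↔
      ∃ s t : ℝ, 0 ≤ s ∧ 0 ≤ t ∧ s ^ 2 + t ^ 2 + s * t = 1 ∧ x = c + s • (p - c) + t • (q - c) := by
  have hi : 2 * ⟪p - c, q - c⟫ = 1 := by
    have e := norm_sub_sq_real (p - c) (q - c)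
    rw [sub_sub_sub_cancel_right, ← dist_eq_norm, ← dist_eq_norm, ← dist_eq_norm, hpq,
      dist_comm p, hp, dist_comm q, hq] at e
    linarith
  have key : ∀ s t : ℝ, x - c = s • (p - c) + t • (q - c) →
      dist x c ^ 2 = s ^ 2 + t ^ 2 + s * t := by
    intro s t h
    rw [dist_eq_norm, h, norm_add_sq_real, norm_smul, norm_smul, mul_pow, mul_pow,
      ← dist_eq_norm, ← dist_eq_norm, dist_comm p, dist_comm q, hp, hq, real_inner_smul_left,
      real_inner_smul_right, Real.norm_eq_abs, Real.norm_eq_abs, sq_abs, sq_abs]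
    linear_combination s * t * hi
  simp only [geodesic, mem_ofPred_eq, mem_sphere]
  constructor
  · rintro ⟨h1, s, t, hs, ht, h⟩
    have := key s t h
    rw [h1] at this
    exact ⟨s, t, hs, ht, by linarith, by rw [add_assoc, ← h]; abel⟩
  · rintro ⟨s, t, hs, ht, h1, rfl⟩
    have h := key s t (by abel)
    rw [h1] at h
    exact ⟨by nlinarith [dist_nonneg (x := c + s • (p - c) + t • (q - c)) (y := c)],
      s, t, hs, ht, by abel⟩

/-- The configuration of two points `p`, `q` at distance one, and a third point `c` at distance one
from both of them, in terms of the midpoint of `p` and `q`. -/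
structure IsUnitTriangle (m u v p q c : E3) : Prop where
  norm_axis : ‖u‖ = 1
  inner_axis : ⟪u, v⟫ = 0
  inner_self : ⟪v, v⟫ = 3 / 4
  left_eq : p = m - (2 : ℝ)⁻¹ • u
  right_eq : q = m + (2 : ℝ)⁻¹ • u
  apex_eq : c = m + v

theorem isUnitTriangle {c p q : E3} (hp : dist c p = 1) (hq : dist c q = 1) (hpq : dist p q = 1) :
    IsUnitTriangle (p + (2 : ℝ)⁻¹ • (q - p)) (q - p) (c - (p + (2 : ℝ)⁻¹ • (q - p))) p q c := by
  have hu : ‖q - p‖ = 1 := by rw [← dist_eq_norm, dist_comm, hpq]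
  have hi : 2 * ⟪q - p, c - p⟫ = 1 := by
    have e := norm_sub_sq_real (q - p) (c - p)
    rw [sub_sub_sub_cancel_right, ← dist_eq_norm, ← dist_eq_norm, ← dist_eq_norm,
      dist_comm q p, hpq, dist_comm q, hq, hp] at e
    linarith
  have hc : ⟪c - p, c - p⟫ = 1 := by
    rw [real_inner_self_eq_norm_sq, ← dist_eq_norm, hp, one_pow]
  have hu' : ⟪q - p, q - p⟫ = 1 := by rw [real_inner_self_eq_norm_sq, hu, one_pow]
  have e : c - (p + (2 : ℝ)⁻¹ • (q - p)) = (c - p) - (2 : ℝ)⁻¹ • (q - p) := by abel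
  refine ⟨hu, ?_, ?_, by module, by module, by abel⟩
  · rw [e, inner_sub_right, real_inner_smul_right, hu']; linarith
  · rw [e, real_inner_self_eq_norm_sq, norm_sub_sq_real, norm_smul, mul_pow,
      ← real_inner_self_eq_norm_sq, hc, hu, real_inner_smul_right, real_inner_comm]
    norm_num
    linarith

namespace IsUnitTriangle

variable {m u v p q c : E3}

theorem dist_left (h : IsUnitTriangle m u v p q c) : dist c p = 1 := by
  rw [dist_eq_norm, ← pow_eq_one_iff_of_nonneg (norm_nonneg _) two_ne_zero, h.apex_eq, h.left_eq,
    show m + v - (m - (2 : ℝ)⁻¹ • u) = v + (2 : ℝ)⁻¹ • u by abel, norm_add_sq_real,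
    ← real_inner_self_eq_norm_sq, h.inner_self, real_inner_smul_right, real_inner_comm,
    h.inner_axis, norm_smul, h.norm_axis]
  norm_num

theorem dist_right (h : IsUnitTriangle m u v p q c) : dist c q = 1 := by
  rw [dist_eq_norm, ← pow_eq_one_iff_of_nonneg (norm_nonneg _) two_ne_zero, h.apex_eq, h.right_eq,
    show m + v - (m + (2 : ℝ)⁻¹ • u) = v - (2 : ℝ)⁻¹ • u by abel, norm_sub_sq_real,
    ← real_inner_self_eq_norm_sq, h.inner_self, real_inner_smul_right, real_inner_comm,
    h.inner_axis, norm_smul, h.norm_axis]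
  norm_num

theorem sub_eq (h : IsUnitTriangle m u v p q c) : q - p = u := by
  rw [h.right_eq, h.left_eq]; module

theorem dist_axis (h : IsUnitTriangle m u v p q c) : dist p q = 1 := by
  rw [dist_comm, dist_eq_norm, h.sub_eq, h.norm_axis]

theorem inner_axis_self (h : IsUnitTriangle m u v p q c) : ⟪u, u⟫ = 1 := by
  rw [real_inner_self_eq_norm_sq, h.norm_axis, one_pow]

theorem inner_cross (h : IsUnitTriangle m u v p q c) : ⟪cross u v, cross u v⟫ = 3 / 4 := by
  rw [inner_cross_cross, h.inner_axis_self, h.inner_self, h.inner_axis]; norm_num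

theorem axisRotation_apex (h : IsUnitTriangle m u v p q c) (θ : ℝ) :
    axisRotation p u θ c = m + (Real.cos θ • v + Real.sin θ • cross u v) := by
  have e : c - p = v + (2 : ℝ)⁻¹ • u := by rw [h.apex_eq, h.left_eq]; abel
  rw [axisRotation, e, cross_add, cross_smul, cross_self, inner_add_right, real_inner_smul_right,
    h.inner_axis, h.inner_axis_self, h.left_eq]
  module

theorem rotate (h : IsUnitTriangle m u v p q c) (θ : ℝ) :
    IsUnitTriangle m u (Real.cos θ • v + Real.sin θ • cross u v) p q (axisRotation p u θ c) where
  norm_axis := h.norm_axis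
  inner_axis := by
    rw [inner_add_right, real_inner_smul_right, real_inner_smul_right, h.inner_axis,
      inner_cross_left]
    ring
  inner_self := by
    simp only [inner_add_right, inner_add_left, real_inner_smul_right, real_inner_smul_left,
      h.inner_self, inner_cross_right, h.inner_cross, real_inner_comm v (cross u v)]
    linear_combination (3 / 4) * Real.sin_sq_add_cos_sq θ
  left_eq := h.left_eq
  right_eq := h.right_eq
  apex_eq := h.axisRotation_apex θ

theorem image_geodesic (h : IsUnitTriangle m u v p q c) (θ : ℝ) :
    axisRotation p u θ '' geodesic c p q = geodesic (axisRotation p u θ c) p q := by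
  have hq : axisRotation p u θ q = q := by
    rw [show q = p + u by rw [← h.sub_eq]; abel, axisRotation_axis h.norm_axis]
  have h' := h.rotate θ
  ext y
  rw [mem_image, mem_geodesic h'.dist_left h'.dist_right h.dist_axis]
  simp only [mem_geodesic h.dist_left h.dist_right h.dist_axis]
  constructor
  · rintro ⟨x, ⟨s, t, hs, ht, hst, rfl⟩, rfl⟩
    exact ⟨s, t, hs, ht, hst, by rw [axisRotation_combination, axisRotation_base, hq]⟩
  · rintro ⟨s, t, hs, ht, hst, rfl⟩
    exact ⟨_, ⟨s, t, hs, ht, hst, rfl⟩, by rw [axisRotation_combination, axisRotation_base, hq]⟩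

/-- Over a fixed axis, the geodesic determines the centre of its sphere. -/
theorem eq_of_geodesic_subset {w d : E3} (h : IsUnitTriangle m u v p q c)
    (h' : IsUnitTriangle m u w p q d) (hsub : geodesic c p q ⊆ geodesic d p q) : v = w := by
  have h3 : √3 ^ 2 = 3 := Real.sq_sqrt (by norm_num)
  have h30 : 0 < √3 := by positivity
  -- Equal coefficients `r` with `3 * r ^ 2 = 1` give the midpoint of the arc. It determines the
  -- apex because `1 - 2 * r ≠ 0`.
  set r := (√3)⁻¹ with hr
  have hr2 : 3 * r ^ 2 = 1 := by rw [hr, inv_pow, h3]; norm_num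
  have hr0 : 0 < r := by positivity
  have hx := hsub ((mem_geodesic h.dist_left h.dist_right h.dist_axis).2
    ⟨r, r, hr0.le, hr0.le, by linarith, rfl⟩)
  obtain ⟨s, t, hs, ht, hst, e⟩ := (mem_geodesic h'.dist_left h'.dist_right h.dist_axis).1 hx
  rw [h.apex_eq, h'.apex_eq, h.left_eq, h.right_eq] at e
  have e1 : (1 - 2 * r) • v = (1 - s - t) • w + ((t - s) / 2) • u := by
    rw [← sub_eq_zero] at e ⊢
    rw [← e]; module
  have e2 := congrArg (fun y => ⟪u, y⟫) e1
  simp only [inner_add_right, real_inner_smul_right, h.inner_axis, h'.inner_axis,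
    h.inner_axis_self] at e2
  have hts : t = s := by linarith
  subst hts
  have htr : t = r := by nlinarith
  rw [htr, sub_self, zero_div, zero_smul, add_zero, show 1 - r - r = 1 - 2 * r by ring] at e1
  refine smul_right_injective E3 (show 1 - 2 * r ≠ 0 from fun h0 => ?_) e1
  nlinarith

end IsUnitTriangle

/-- The surface swept out by a geodesic is the union of the geodesics about the points of the
circular arc swept out by its centre. -/
theorem mem_sweptSurface {m u v w p q c d : E3} (h : IsUnitTriangle m u v p q c)
    (h' : IsUnitTriangle m u w p q d) (hvw : ⟪v, w⟫ = 1 / 4) {y : E3} :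
    y ∈ sweptSurface p q (geodesic c p q) (geodesic d p q) ↔
      ∃ s t : ℝ, 0 ≤ s ∧ 0 ≤ t ∧ 3 * s ^ 2 + 3 * t ^ 2 + 2 * s * t = 3 ∧
        y ∈ geodesic (m + s • v + t • w) p q := by
  -- The angle from `v` to `w` has cosine `1 / 3`, and `δ` is its sine, with a sign that depends on
  -- the orientation.
  obtain ⟨δ, hδ⟩ : ∃ δ : ℝ, w = (3 : ℝ)⁻¹ • v + δ • cross u v := by
    refine ⟨4 / 3 * ⟪cross u v, w⟫, ?_⟩
    have e := smul_eq_cross_combination u v w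
    rw [h.inner_cross, h.inner_axis, h'.inner_axis, hvw, h.inner_axis_self] at e
    have e2 := congrArg (fun x => (4 / 3 : ℝ) • x) e
    simp only [smul_add, smul_smul] at e2
    norm_num at e2
    exact e2.trans (by module)
  have hδ2 : δ ^ 2 = 8 / 9 := by
    have e := h'.inner_self
    rw [hδ] at e
    simp only [inner_add_right, inner_add_left, real_inner_smul_right, real_inner_smul_left,
      h.inner_self, inner_cross_right, h.inner_cross, real_inner_comm v (cross u v)] at e
    linarith
  rw [sweptSurface, mem_ofPred_eq, h.sub_eq, h.norm_axis, inv_one, one_smul]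
  constructor
  · rintro ⟨φ, hφ, himg, θ, hθ, hy⟩
    rw [h.image_geodesic] at himg hy
    have hw := (h.rotate φ).eq_of_geodesic_subset h' himg.subset
    have hcos : Real.cos φ = 1 / 3 := by
      have e := congrArg (fun x => ⟪v, x⟫) hw
      simp only [inner_add_right, real_inner_smul_right, h.inner_self, inner_cross_right, hvw] at e
      linarith
    have hsin : Real.sin φ = δ := by
      have e := congrArg (fun x => ⟪cross u v, x⟫) (hw.trans hδ)
      simp only [inner_add_right, real_inner_smul_right, inner_cross_right, h.inner_cross,
        real_inner_comm v (cross u v)] at e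
      linarith
    have hδ0 : δ ≠ 0 := by rintro rfl; norm_num at hδ2
    -- These are the coefficients of the rotated `v` in terms of `v` and `w`, namely `sin (φ - θ) /
    -- δ` and `sin θ / δ`. They are nonnegative as `θ` lies between `0` and `φ`.
    have hst : 0 ≤ Real.cos θ - Real.sin θ / (3 * δ) ∧ 0 ≤ Real.sin θ / δ := by
      have hsub := Real.sin_sub φ θ
      rw [hsin, hcos] at hsub
      have e : Real.cos θ - Real.sin θ / (3 * δ) = Real.sin (φ - θ) / δ := by
        rw [hsub]; field_simp
      rw [e]
      rcases le_total 0 φ with h0 | h0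
      · rw [uIcc_of_le h0] at hθ
        have hδp : 0 ≤ δ := hsin ▸ Real.sin_nonneg_of_nonneg_of_le_pi h0 hφ.2.le
        exact ⟨div_nonneg (Real.sin_nonneg_of_nonneg_of_le_pi (by linarith [hθ.2])
          (by linarith [hθ.1, hφ.2])) hδp, div_nonneg
          (Real.sin_nonneg_of_nonneg_of_le_pi hθ.1 (by linarith [hθ.2, hφ.2])) hδp⟩
      · rw [uIcc_of_ge h0] at hθ
        have hδp : δ ≤ 0 := hsin ▸ Real.sin_nonpos_of_nonpos_of_neg_pi_le h0 hφ.1.le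
        exact ⟨div_nonneg_of_nonpos (Real.sin_nonpos_of_nonpos_of_neg_pi_le (by linarith [hθ.1])
          (by linarith [hθ.2, hφ.1])) hδp, div_nonneg_of_nonpos
          (Real.sin_nonpos_of_nonpos_of_neg_pi_le hθ.2 (by linarith [hθ.1, hφ.1])) hδp⟩
    refine ⟨_, _, hst.1, hst.2, ?_, ?_⟩
    all_goals
      have e : Real.sin θ = δ * (Real.sin θ / δ) := by field_simp
      have e2 : Real.sin θ / (3 * δ) = (Real.sin θ / δ) / 3 := by field_simp
      set t := Real.sin θ / δ
    · rw [e2]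
      have := Real.sin_sq_add_cos_sq θ
      rw [e] at this
      linear_combination 3 * this - 3 * t ^ 2 * hδ2
    · rw [h.axisRotation_apex, e] at hy
      rw [e2, hδ]
      have e3 : m + (Real.cos θ - t / 3) • v + t • ((3 : ℝ)⁻¹ • v + δ • cross u v) =
          m + (Real.cos θ • v + (δ * t) • cross u v) := by module
      rwa [e3]
  · rintro ⟨s, t, hs, ht, hst, hy⟩
    have ht1 : t ≤ 1 := by nlinarith [mul_nonneg hs ht]
    have hδabs := abs_le_of_sq_le_sq' (show δ ^ 2 ≤ 1 ^ 2 by linarith) zero_le_one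
    -- Both angles have nonnegative cosine, so `arcsin` recovers them, whatever the sign of `δ`.
    have hsinφ : Real.sin (Real.arcsin δ) = δ := Real.sin_arcsin hδabs.1 hδabs.2
    have hcosφ : Real.cos (Real.arcsin δ) = 3⁻¹ := by
      rw [Real.cos_arcsin, hδ2, Real.sqrt_eq_iff_mul_self_eq (by norm_num) (by norm_num)]
      norm_num
    have hdt : (δ * t) ^ 2 ≤ 1 ^ 2 := by rw [mul_pow, hδ2]; nlinarith
    have hdt' := abs_le_of_sq_le_sq' hdt zero_le_one
    have hsinθ : Real.sin (Real.arcsin (δ * t)) = δ * t := Real.sin_arcsin hdt'.1 hdt'.2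
    have hcosθ : Real.cos (Real.arcsin (δ * t)) = s + t / 3 := by
      rw [Real.cos_arcsin, Real.sqrt_eq_iff_mul_self_eq (by nlinarith) (by positivity), mul_pow,
        hδ2]
      linarith
    refine ⟨Real.arcsin δ, ⟨?_, ?_⟩, ?_, Real.arcsin (δ * t), ?_, ?_⟩
    · linarith [Real.neg_pi_div_two_le_arcsin δ, Real.pi_pos]
    · linarith [Real.arcsin_le_pi_div_two δ, Real.pi_pos]
    · rw [h.image_geodesic, h.axisRotation_apex, hsinφ, hcosφ, ← hδ, ← h'.apex_eq]
    · rw [← Real.arcsin_zero]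
      rcases le_total 0 δ with h0 | h0
      · rw [uIcc_of_le (Real.monotone_arcsin h0)]
        exact ⟨Real.monotone_arcsin (by positivity), Real.monotone_arcsin (by nlinarith)⟩
      · rw [uIcc_of_ge (Real.monotone_arcsin h0)]
        exact ⟨Real.monotone_arcsin (by nlinarith), Real.monotone_arcsin (by nlinarith)⟩
    · rw [h.image_geodesic, h.axisRotation_apex, hsinθ, hcosθ]
      have e : m + ((s + t / 3) • v + (δ * t) • cross u v) = m + s • v + t • w := by
        rw [hδ]; module
      rwa [e]

theorem lin_vertex_sub {a : Fin 4 → E3} (ha : IsUnitTetrahedron a) (n i j : Fin 4) :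
    lin a n (a i - a j) = (if i = n then 1 else 0) - if j = n then 1 else 0 := by
  rw [lin_vsub, bary_vertex ha, bary_vertex ha]

theorem nodup_ne {i j k l : Fin 4} (h : [i, j, k, l].Nodup) :
    i ≠ j ∧ i ≠ k ∧ i ≠ l ∧ j ≠ k ∧ j ≠ l ∧ k ≠ l := by
  revert h; revert i j k l; decide

/-- The centre of the rotating geodesic runs from `a k` to `a l` on a circle about the midpoint of
`a i` and `a j`. In barycentric coordinates this arc satisfies the same relation as the opposite
edge. -/
theorem mem_spindlePiece {a : Fin 4 → E3} (ha : IsUnitTetrahedron a) {i j k l : Fin 4}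
    (h : [i, j, k, l].Nodup) {y : E3} :
    y ∈ spindlePiece a i j k l ↔ ∃ p ∈ edge a k l, y ∈ geodesic p (a i) (a j) := by
  obtain ⟨hij, hik, hil, hjk, hjl, hkl⟩ := nodup_ne h
  have h1 := isUnitTriangle (ha k i hik.symm) (ha k j hjk.symm) (ha i j hij)
  have h2 := isUnitTriangle (ha l i hil.symm) (ha l j hjl.symm) (ha i j hij)
  set m := a i + (2 : ℝ)⁻¹ • (a j - a i) with hm
  have hbm : ∀ n, bary a n m = ((if i = n then 1 else 0) + if j = n then 1 else 0) / 2 := by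
    intro n
    rw [hm, bary_add, lin_smul, lin_vertex_sub ha, bary_vertex ha]
    ring
  have hvw : ⟪a k - m, a l - m⟫ = 1 / 4 := by
    rw [inner_eq_lin ha, sum_eq_of_nodup h]
    simp only [lin_vsub, hbm, bary_vertex ha]
    simp [hij, hik, hil, hjk, hjl, hkl, hij.symm, hik.symm, hil.symm, hjk.symm, hjl.symm, hkl.symm]
    norm_num
  rw [spindlePiece, mem_sweptSurface h1 h2 hvw]
  constructor
  · rintro ⟨s, t, hs, ht, hst, hy⟩
    refine ⟨_, ?_, hy⟩
    rw [mem_edge_iff ha h]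
    simp only [bary_add, lin_smul, lin_vsub, hbm, bary_vertex ha]
    simp [hij.symm, hik.symm, hil.symm, hjk.symm, hjl.symm, hkl.symm, *]
  · rintro ⟨p, hp, hy⟩
    obtain ⟨e1, e2, e3, e4⟩ := (mem_edge_iff ha h).1 hp
    refine ⟨_, _, e2, e3, e4, ?_⟩
    have hs := sum_bary a p
    rw [sum_eq_of_nodup h] at hs
    convert hy using 2
    apply eq_of_bary_eq ha
    intro n
    simp only [bary_add, lin_smul, lin_vsub, hbm, bary_vertex ha]
    rcases eq_of_nodup h n with rfl | rfl | rfl | rfl <;>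
    simp [hij, hik, hil, hjk, hjl, hkl, hij.symm, hik.symm, hil.symm, hjk.symm, hjl.symm,
      hkl.symm] <;> linarith

/-! ### The region of the boundary near an edge. -/

theorem mem_geodesic_vertex {a : Fin 4 → E3} (ha : IsUnitTetrahedron a) {i j k l : Fin 4}
    (h : [i, j, k, l].Nodup) {x : E3} :
    x ∈ geodesic (a k) (a i) (a j) ↔ 0 ≤ bary a i x ∧ 0 ≤ bary a j x ∧ bary a l x = 0 ∧
      bary a i x ^ 2 + bary a j x ^ 2 + bary a i x * bary a j x = 1 := by
  obtain ⟨hij, hik, hil, hjk, hjl, hkl⟩ := nodup_ne h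
  rw [mem_geodesic (ha k i hik.symm) (ha k j hjk.symm) (ha i j hij)]
  constructor
  · rintro ⟨s, t, hs, ht, hst, rfl⟩
    simp only [bary_add, lin_smul, lin_vertex_sub ha, bary_vertex ha]
    simp [hij.symm, hik.symm, hjk.symm, *]
  · rintro ⟨h1, h2, h3, h4⟩
    refine ⟨_, _, h1, h2, h4, eq_of_bary_eq ha fun n => ?_⟩
    have hs := sum_bary a x
    rw [sum_eq_of_nodup h] at hs
    simp only [bary_add, lin_smul, lin_vertex_sub ha, bary_vertex ha]
    rcases eq_of_nodup h n with rfl | rfl | rfl | rfl <;>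
    simp [hij, hij.symm, hik, hik.symm, hjk, hjk.symm, hil, hjl, hkl, h3]
    linarith

/-- A negative `i` coordinate would push the `j` coordinate above one, and the point out of the ball
about `a i`. -/
theorem nonneg_of_mem_reuleaux {a : Fin 4 → E3} (ha : IsUnitTetrahedron a) {i j k l : Fin 4}
    (h : [i, j, k, l].Nodup) {x : E3} (hx : x ∈ reuleaux a) (hk : bary a k x ≤ 0)
    (hl : bary a l x ≤ 0) : 0 ≤ bary a i x := by
  by_contra! hi
  have hs := sum_bary a x
  have hd := (dist_vertex_le_iff ha x i).1 (mem_reuleaux.1 hx i)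
  rw [sum_eq_of_nodup h] at hs hd
  nlinarith [sq_nonneg (bary a i x), sq_nonneg (bary a k x), sq_nonneg (bary a l x)]

/-- The part of the boundary of the Reuleaux tetrahedron in one of the faces of a wedge at the line
through `a i` and `a j` is a geodesic. -/
theorem mem_geodesic_of_mem_frontier {a : Fin 4 → E3} (ha : IsUnitTetrahedron a) {i j k l : Fin 4}
    (h : [i, j, k, l].Nodup) {x : E3} (hx : x ∈ frontier (reuleaux a)) (hk : bary a k x ≤ 0)
    (hl : bary a l x = 0) : x ∈ geodesic (a k) (a i) (a j) := by
  have h' : [j, i, k, l].Nodup := by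
    clear hx hk hl; revert h; revert i j k l; decide
  obtain ⟨hx, n, hn⟩ := mem_frontier_reuleaux.1 hx
  have hi := nonneg_of_mem_reuleaux ha h hx hk hl.le
  have hj := nonneg_of_mem_reuleaux ha h' hx hk hl.le
  have hdk := (dist_vertex_le_iff ha x k).1 (mem_reuleaux.1 hx k)
  rw [dist_vertex_eq_iff ha] at hn
  -- The `k` coordinate is smallest, so the point lies on the sphere about `a k` as well.
  have hnk : bary a k x ≤ bary a n x := by
    rcases eq_of_nodup h n with rfl | rfl | rfl | rfl <;> linarith
  have hs := sum_bary a x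
  rw [sum_eq_of_nodup h] at hs hn hdk
  refine (mem_geodesic_vertex ha h).2 ⟨hi, hj, hl, ?_⟩
  have hkeq : bary a k x = 1 - bary a i x - bary a j x := by linarith
  rw [hl, hkeq] at hdk hn
  nlinarith

/-- The midpoint of `a i` and `a j` is interior and lies on both planes of the wedge. Radial
projection from it, written with the gauge, maps a convex cone onto this part of the boundary. -/
theorem isPreconnected_wedge {a : Fin 4 → E3} (ha : IsUnitTetrahedron a) {i j k l : Fin 4}
    (h : [i, j, k, l].Nodup) :
    IsPreconnected {x | x ∈ frontier (reuleaux a) ∧ bary a k x < 0 ∧ bary a l x < 0} := by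
  obtain ⟨hij, hik, hil, hjk, hjl, hkl⟩ := nodup_ne h
  set m := a i + (2 : ℝ)⁻¹ • (a j - a i) with hm
  have hbm : ∀ n, bary a n m = ((if i = n then 1 else 0) + if j = n then 1 else 0) / 2 := by
    intro n
    rw [hm, bary_add, lin_smul, lin_vertex_sub ha, bary_vertex ha]
    ring
  have hbk : ∀ v, bary a k (m + v) = lin a k v := fun v => by
    rw [bary_add, hbm]; simp [hik, hjk]
  have hbl : ∀ v, bary a l (m + v) = lin a l v := fun v => by
    rw [bary_add, hbm]; simp [hil, hjl]
  set K : Set E3 := (Homeomorph.addLeft m) ⁻¹' reuleaux a with hK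
  have hmint : m ∈ interior (reuleaux a) := by
    refine mem_interior_ballInter (finite_range a).isCompact ?_
    rintro _ ⟨n, rfl⟩
    rw [← sq_lt_one_iff₀ dist_nonneg, dist_vertex_sq ha, sum_eq_of_nodup h]
    simp only [hbm]
    rcases eq_of_nodup h n with rfl | rfl | rfl | rfl <;>
    simp [hij, hij.symm, hik, hil, hjk, hjl] <;> norm_num
  have hK0 : K ∈ nhds (0 : E3) := by
    refine (Homeomorph.addLeft m).continuous.continuousAt.preimage_mem_nhds ?_
    simpa using mem_interior_iff_mem_nhds.1 hmint
  have hKc : Convex ℝ K := by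
    have : K = (fun z => m + z) ⁻¹' reuleaux a := rfl
    rw [this]
    exact (convex_ballInter _).translate_preimage_right m
  have hKb : Bornology.IsBounded K := by
    have : IsCompact K := (Homeomorph.addLeft m).isCompact_preimage.2
      (isCompact_ballInter (range_nonempty a))
    exact this.isBounded
  have hfr : ∀ v, m + v ∈ frontier (reuleaux a) ↔ gauge K v = 1 := fun v => by
    rw [gauge_eq_one_iff_mem_frontier hKc hK0, hK, ← Homeomorph.preimage_frontier]
    rfl
  have hpos : ∀ v, lin a k v < 0 → 0 < gauge K v := fun v hv => by
    rw [gauge_pos (absorbent_nhds_zero hK0) ((NormedSpace.isVonNBounded_iff ℝ).2 hKb)]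
    rintro rfl
    simp [lin] at hv
  have hC : Convex ℝ {v : E3 | lin a k v < 0 ∧ lin a l v < 0} := by
    rintro x ⟨hx1, hx2⟩ y ⟨hy1, hy2⟩ s t hs ht hst
    simp only [mem_ofPred_eq, lin_add, lin_smul]
    have hp : 0 < s ∨ 0 < t := by
      by_contra! hn; linarith
    rcases hp with hp | hp <;> constructor <;> nlinarith
  have himg : {x | x ∈ frontier (reuleaux a) ∧ bary a k x < 0 ∧ bary a l x < 0} =
      (fun v => m + (gauge K v)⁻¹ • v) '' {v : E3 | lin a k v < 0 ∧ lin a l v < 0} := by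
    ext x
    constructor
    · rintro ⟨h1, h2, h3⟩
      have e : m + (x - m) = x := by abel
      rw [← e] at h1 h2 h3
      rw [hbk] at h2
      rw [hbl] at h3
      refine ⟨x - m, ⟨h2, h3⟩, ?_⟩
      simp only [(hfr _).1 h1, inv_one, one_smul, e]
    · rintro ⟨v, ⟨h1, h2⟩, rfl⟩
      have hg := hpos v h1
      have hg' := inv_pos.2 hg
      refine ⟨?_, ?_, ?_⟩
      · rw [hfr, gauge_smul_of_nonneg hg'.le, smul_eq_mul, inv_mul_cancel₀ hg.ne']
      · rw [hbk, lin_smul]; exact mul_neg_of_pos_of_neg hg' h1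
      · rw [hbl, lin_smul]; exact mul_neg_of_pos_of_neg hg' h2
  rw [himg]
  have hinv : ContinuousOn (fun v => (gauge K v)⁻¹) {v : E3 | lin a k v < 0 ∧ lin a l v < 0} :=
    (continuous_gauge hKc hK0).continuousOn.inv₀ fun v hv => (hpos v hv.1).ne'
  exact hC.isPreconnected.image _ (by fun_prop)

/-- Off the two geodesics, the boundary splits into the open wedge and the open set where one of the
two coordinates is positive. A component starting on the edge cannot leave the wedge; conversely the
wedge part is connected and meets the edge. -/
theorem mem_edgeRegion {a : Fin 4 → E3} (ha : IsUnitTetrahedron a) {i j k l : Fin 4}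
    (h : [i, j, k, l].Nodup) {x : E3} :
    x ∈ edgeRegion a i j k l ↔
      x ∈ frontier (reuleaux a) ∧ bary a k x < 0 ∧ bary a l x < 0 := by
  have h' : [i, j, l, k].Nodup := by revert h; revert i j k l; decide
  have h'' : [k, l, i, j].Nodup := by revert h; revert i j k l; decide
  have hsub : {x | x ∈ frontier (reuleaux a) ∧ bary a k x < 0 ∧ bary a l x < 0} ⊆
      frontier (reuleaux a) \ (geodesic (a k) (a i) (a j) ∪ geodesic (a l) (a i) (a j)) := by
    rintro x ⟨h1, h2, h3⟩
    refine ⟨h1, ?_⟩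
    rintro (hg | hg)
    · exact h3.ne ((mem_geodesic_vertex ha h).1 hg).2.2.1
    · exact h2.ne ((mem_geodesic_vertex ha h').1 hg).2.2.1
  rw [edgeRegion, mem_iUnion₂]
  constructor
  · rintro ⟨y, hy, hx⟩
    have hyF := connectedComponentIn_nonempty_iff.1 ⟨x, hx⟩
    refine ⟨(connectedComponentIn_subset _ _ hx).1, ?_⟩
    have hU : IsOpen {z | bary a k z < 0 ∧ bary a l z < 0} :=
      (isOpen_lt (continuous_bary a k) continuous_const).and
        (isOpen_lt (continuous_bary a l) continuous_const)
    have hV : IsOpen ({z | 0 < bary a k z} ∪ {z | 0 < bary a l z}) :=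
      (isOpen_lt continuous_const (continuous_bary a k)).union
        (isOpen_lt continuous_const (continuous_bary a l))
    refine isPreconnected_connectedComponentIn.subset_left_of_subset_union hU hV ?_ ?_ ?_ hx
    · rw [Set.disjoint_left]
      rintro z ⟨h1, h2⟩ (h3 | h3)
      exacts [lt_asymm h1 h3, lt_asymm h2 h3]
    · intro z hz
      have hz := connectedComponentIn_subset _ _ hz
      by_contra hn
      simp only [mem_union, mem_ofPred_eq, not_or, not_and_or, not_lt] at hn
      obtain ⟨h1, h2, h3⟩ := hn
      rcases h1 with h1 | h1
      · exact hz.2 (Or.inr (mem_geodesic_of_mem_frontier ha h' hz.1 h3 (le_antisymm h2 h1)))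
      · exact hz.2 (Or.inl (mem_geodesic_of_mem_frontier ha h hz.1 h2 (le_antisymm h3 h1)))
    · refine ⟨y, mem_connectedComponentIn hyF, ?_⟩
      obtain ⟨h1, h2, h3, h4⟩ := (mem_edge_iff ha h'').1 hy
      obtain ⟨h5, -⟩ := one_le_add_of_mem_edge ha h'' hy
      have hs := sum_bary a y
      rw [sum_eq_of_nodup h] at hs
      have hle : bary a l y ≤ 0 := by linarith
      have hne : bary a l y ≠ 0 := by
        intro h0
        refine hyF.2 (Or.inl ((mem_geodesic_vertex ha h).2 ⟨h2, h3, h0, ?_⟩))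
        have e : bary a j y = 1 - bary a i y := by linarith
        rw [e] at h4 ⊢
        linarith
      have hlt := lt_of_le_of_ne hle hne
      exact ⟨h1 ▸ hlt, hlt⟩
  · intro hx
    obtain ⟨hij, hik, hil, hjk, hjl, hkl⟩ := nodup_ne h
    -- The midpoint of the edge: equal coordinates `s` with `8 * s ^ 2 = 3`.
    set s := √(3 / 8) with hs
    have hs2 : s ^ 2 = 3 / 8 := Real.sq_sqrt (by norm_num)
    have hs0 : 0 ≤ s := Real.sqrt_nonneg _
    have hs1 : 1 / 2 < s := by nlinarith
    have hb := bary_sum ha (fun n => if n = i ∨ n = j then s else 1 / 2 - s) (by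
      rw [sum_eq_of_nodup h]
      simp [hik.symm, hil.symm, hjk.symm, hjl.symm]
      ring)
    set y := ∑ n, (if n = i ∨ n = j then s else 1 / 2 - s) • a n
    have hbi : bary a i y = s := by simp [hb]
    have hbj : bary a j y = s := by simp [hb]
    have hbk : bary a k y = 1 / 2 - s := by simp [hb, hik.symm, hjk.symm]
    have hbl : bary a l y = 1 / 2 - s := by simp [hb, hil.symm, hjl.symm]
    have hy : y ∈ edge a i j := (mem_edge_iff ha h'').2
      ⟨by rw [hbk, hbl], hbi ▸ hs0, hbj ▸ hs0, by rw [hbi, hbj]; linarith⟩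
    obtain ⟨hyR, hyk, -⟩ := (mem_edge h'').1 hy
    refine ⟨y, hy, (isPreconnected_wedge ha h).subset_connectedComponentIn
      ⟨mem_frontier_reuleaux.2 ⟨hyR, k, hyk⟩, ?_, ?_⟩ hsub hx⟩
    · rw [hbk]; linarith
    · rw [hbl]; linarith

/-! ### The centres of the balls. -/

/-- From every pair of opposite edges exactly one is selected. -/
def IsSelection (S : Set (Sym2 (Fin 4))) : Prop :=
  ∀ i j k l : Fin 4, [i, j, k, l].Nodup → (s(i, j) ∈ S ↔ s(k, l) ∉ S)

/-- The vertices, together with the edges opposite to the edges in `S`. -/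
def ballCenters (a : Fin 4 → E3) (S : Set (Sym2 (Fin 4))) : Set E3 :=
  range a ∪ {x | ∃ i j k l, IsLabelling S i j k l ∧ x ∈ edge a k l}

theorem mem_ballCenters {a : Fin 4 → E3} {S : Set (Sym2 (Fin 4))} {x : E3} :
    x ∈ ballCenters a S ↔ (∃ n, a n = x) ∨ ∃ i j k l, IsLabelling S i j k l ∧ x ∈ edge a k l :=
  Iff.rfl

theorem vertex_mem_ballCenters (a : Fin 4 → E3) (S : Set (Sym2 (Fin 4))) (n : Fin 4) :
    a n ∈ ballCenters a S := Or.inl ⟨n, rfl⟩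

theorem vertex_mem_reuleaux {a : Fin 4 → E3} (ha : IsUnitTetrahedron a) (n : Fin 4) :
    a n ∈ reuleaux a := by
  refine mem_reuleaux.2 fun m => ?_
  rcases eq_or_ne n m with rfl | h
  · simp
  · exact (ha n m h).le

theorem ballCenters_subset_reuleaux {a : Fin 4 → E3} (ha : IsUnitTetrahedron a)
    (S : Set (Sym2 (Fin 4))) : ballCenters a S ⊆ reuleaux a := by
  rintro x (⟨n, rfl⟩ | ⟨i, j, k, l, h, hx⟩)
  · exact vertex_mem_reuleaux ha n
  · exact ((mem_edge h.1).1 hx).1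

theorem isClosed_edge (a : Fin 4 → E3) (i j : Fin 4) : IsClosed (edge a i j) :=
  isClosed_biInter fun _ _ => isClosed_sphere.inter (isClosed_ballInter _)

theorem isCompact_ballCenters {a : Fin 4 → E3} (ha : IsUnitTetrahedron a)
    (S : Set (Sym2 (Fin 4))) : IsCompact (ballCenters a S) := by
  have hR : IsCompact (reuleaux a) := isCompact_ballInter (range_nonempty a)
  refine hR.of_isClosed_subset ?_ (ballCenters_subset_reuleaux ha S)
  have e : ballCenters a S =
      range a ∪ ⋃ i, ⋃ j, ⋃ k, ⋃ l, ⋃ _ : IsLabelling S i j k l, edge a k l := by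
    ext x; simp [mem_ballCenters]
  rw [e]
  refine (finite_range a).isClosed.union ?_
  iterate 5 refine isClosed_iUnion_of_finite fun _ => ?_
  exact isClosed_edge a _ _

theorem ballInter_ballCenters_subset (a : Fin 4 → E3) (S : Set (Sym2 (Fin 4))) :
    ballInter (ballCenters a S) ⊆ reuleaux a := fun _ hx =>
  mem_reuleaux.2 fun n => mem_ballInter.1 hx _ (vertex_mem_ballCenters a S n)

theorem dist_edge_le_one {a : Fin 4 → E3} (ha : IsUnitTetrahedron a) {i j k l : Fin 4}
    (h : [i, j, k, l].Nodup) {p x : E3} (hp : p ∈ edge a k l) (hx : x ∈ reuleaux a)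
    (hn : ¬ (bary a k x < 0 ∧ bary a l x < 0)) : dist x p ≤ 1 := by
  rcases dist_edge_le ha h hp hn with h1 | h1
  · exact h1.trans (mem_reuleaux.1 hx k)
  · exact h1.trans (mem_reuleaux.1 hx l)

/-- A centre farther than one from a point of an edge lies in the wedge at the opposite edge, hence
on that opposite edge; a selection never supplies both edges of such a pair. -/
theorem ballCenters_subset_ballInter {a : Fin 4 → E3} (ha : IsUnitTetrahedron a)
    {S : Set (Sym2 (Fin 4))} (hS : IsSelection S) :
    ballCenters a S ⊆ ballInter (ballCenters a S) := by
  intro q hq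
  have hqR := ballCenters_subset_reuleaux ha S hq
  refine mem_ballInter.2 fun p hp => ?_
  rcases hp with ⟨n, rfl⟩ | ⟨i, j, k, l, h, hp⟩
  · exact mem_reuleaux.1 hqR n
  refine dist_edge_le_one ha h.1 hp hqR ?_
  rintro ⟨hk, hl⟩
  rcases hq with ⟨n, rfl⟩ | ⟨i', j', k', l', h', hq⟩
  · rw [bary_vertex ha] at hk
    split_ifs at hk <;> norm_num at hk
  · obtain ⟨-, h1, h2, -⟩ := (mem_edge_iff ha h'.1).1 hq
    have n1 : k ≠ k' := by rintro rfl; linarith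
    have n2 : k ≠ l' := by rintro rfl; linarith
    have n3 : l ≠ k' := by rintro rfl; linarith
    have n4 : l ≠ l' := by rintro rfl; linarith
    have e : s(i', j') = s(k, l) := by
      have hkl := (nodup_ne h.1).2.2.2.2.2
      have ek := eq_of_nodup h'.1 k
      have el := eq_of_nodup h'.1 l
      simp only [n1, n2, n3, n4, or_false] at ek el
      rcases ek with rfl | rfl <;> rcases el with rfl | rfl <;>
      first | rfl | exact Sym2.eq_swap | exact absurd rfl hkl
    have hmem : s(k, l) ∈ S := e ▸ h'.2
    exact (hS i j k l h.1).1 h.2 hmem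

/-- Points of a spindle piece have distance one from a point of the opposite edge, and are close to
everything that is close to the ends of the edge. -/
theorem exists_edge_of_mem_spindlePiece {a : Fin 4 → E3} (ha : IsUnitTetrahedron a)
    {i j k l : Fin 4} (h : [i, j, k, l].Nodup) {x : E3} (hx : x ∈ spindlePiece a i j k l) :
    (∃ p ∈ edge a k l, dist x p = 1) ∧
      ∀ z, dist z (a i) ≤ 1 → dist z (a j) ≤ 1 → dist z x ≤ 1 := by
  obtain ⟨p, hp, hxs, s, t, hs, ht, e⟩ := (mem_spindlePiece ha h).1 hx
  obtain ⟨-, hi, hj⟩ := (mem_edge h).1 hp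
  rw [dist_comm] at hi hj
  rw [mem_sphere] at hxs
  have e' : x - p = s • (a i - p) + t • (a j - p) + (0 : ℝ) • (a j - p) := by
    rw [e, zero_smul, add_zero]
  refine ⟨⟨p, hp, hxs⟩, fun z h1 h2 => hxs ▸ dist_le_of_mem_cone hs ht le_rfl
    (one_le_of_dist_eq_one hs ht le_rfl e' hi hj hj hxs) e' hi hj hj h1 h2 h2⟩

/-- The edge from `a k` to `a l` meets every direction of the sector spanned by it. -/
theorem exists_mem_edge {a : Fin 4 → E3} (ha : IsUnitTetrahedron a) {i j k l : Fin 4}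
    (h : [i, j, k, l].Nodup) {α β : ℝ} (hα : 0 ≤ α) (hβ : 0 ≤ β) (hαβ : 0 < α + β) :
    ∃ ν > 0, ν ^ 2 * (3 * α ^ 2 + 3 * β ^ 2 + 2 * α * β) = 3 ∧ ∃ p ∈ edge a k l,
      bary a k p = ν * α ∧ bary a l p = ν * β ∧
      bary a i p = (1 - ν * α - ν * β) / 2 ∧ bary a j p = (1 - ν * α - ν * β) / 2 := by
  obtain ⟨hij, hik, hil, hjk, hjl, hkl⟩ := nodup_ne h
  have hD : 0 < 3 * α ^ 2 + 3 * β ^ 2 + 2 * α * β := by nlinarith [mul_nonneg hα hβ]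
  set ν := √(3 / (3 * α ^ 2 + 3 * β ^ 2 + 2 * α * β)) with hν
  have hν2 : ν ^ 2 * (3 * α ^ 2 + 3 * β ^ 2 + 2 * α * β) = 3 := by
    rw [hν, Real.sq_sqrt (by positivity), div_mul_cancel₀ _ hD.ne']
  have hν0 : 0 < ν := Real.sqrt_pos.2 (by positivity)
  obtain ⟨p, hb⟩ : ∃ p, ∀ n, bary a n p = if n = k then ν * α else if n = l then ν * β else
      (1 - ν * α - ν * β) / 2 := by
    refine ⟨_, bary_sum ha (fun n => if n = k then ν * α else if n = l then ν * β else
      (1 - ν * α - ν * β) / 2) ?_⟩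
    rw [sum_eq_of_nodup h]
    simp [hik, hil, hjk, hjl, hkl.symm]
    ring
  refine ⟨ν, hν0, hν2, p, (mem_edge_iff ha h).2 ?_, ?_, ?_, ?_, ?_⟩ <;>
  simp [hb, hik, hil, hjk, hjl, hkl.symm]
  exact ⟨by positivity, by positivity, by linarith⟩

/-! ### The frontier of the intersection is the surgered surface. -/

theorem surgeredSurface_subset {a : Fin 4 → E3} (ha : IsUnitTetrahedron a)
    (S : Set (Sym2 (Fin 4))) :
    surgeredSurface a S ⊆ frontier (ballInter (ballCenters a S)) := by
  intro x hx
  rw [mem_frontier_ballInter (isCompact_ballCenters ha S)]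
  rcases hx with ⟨hfr, hx⟩ | ⟨i, j, k, l, h, hx⟩
  · obtain ⟨hxR, n, hn⟩ := mem_frontier_reuleaux.1 hfr
    refine ⟨mem_ballInter.2 ?_, a n, vertex_mem_ballCenters a S n, hn⟩
    rintro p (⟨m, rfl⟩ | ⟨i, j, k, l, h, hp⟩)
    · exact mem_reuleaux.1 hxR m
    · exact dist_edge_le_one ha h.1 hp hxR fun hn =>
        hx i j k l h ((mem_edgeRegion ha h.1).2 ⟨hfr, hn⟩)
  · obtain ⟨⟨p, hp, hd⟩, hz⟩ := exists_edge_of_mem_spindlePiece ha h.1 hx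
    refine ⟨mem_ballInter.2 fun t ht => ?_, p, Or.inr ⟨i, j, k, l, h, hp⟩, hd⟩
    have htR := mem_reuleaux.1 (ballCenters_subset_reuleaux ha S ht)
    rw [dist_comm]
    exact hz t (htR i) (htR j)

/-- A point of the Reuleaux tetrahedron in the wedge at the edge from `a i` to `a j` lies on the
spindle piece, or has distance less than one from the whole Reuleaux tetrahedron, provided that
its distance to the opposite edge is at most one. -/
theorem mem_spindlePiece_or_dist_lt {a : Fin 4 → E3} (ha : IsUnitTetrahedron a) {i j k l : Fin 4}
    (h : [i, j, k, l].Nodup) {x : E3} (hx : x ∈ reuleaux a)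
    (hd : ∀ p ∈ edge a k l, dist x p ≤ 1) (hk : bary a k x < 0) (hl : bary a l x < 0) :
    x ∈ spindlePiece a i j k l ∨ ∀ z ∈ reuleaux a, dist x z < 1 := by
  obtain ⟨hij, hik, hil, hjk, hjl, hkl⟩ := nodup_ne h
  have h' : [j, i, k, l].Nodup := by
    clear hx hk hl hd; revert h; revert i j k l; decide
  -- The point `p` is where the plane through `x` and the axis meets the opposite edge: its `k` and
  -- `l` coordinates are those of `x` times `-ν`.
  obtain ⟨ν, hν, -, p, hp, hpk, hpl, hpi, hpj⟩ := exists_mem_edge ha h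
    (neg_nonneg.2 hk.le) (neg_nonneg.2 hl.le) (by linarith)
  obtain ⟨-, hi1, hj1⟩ := (mem_edge h).1 hp
  rw [dist_comm] at hi1 hj1
  have hi := nonneg_of_mem_reuleaux ha h hx hk.le hl.le
  have hj := nonneg_of_mem_reuleaux ha h' hx hk.le hl.le
  have hdi := (dist_vertex_le_iff ha x i).1 (mem_reuleaux.1 hx i)
  have hdj := (dist_vertex_le_iff ha x j).1 (mem_reuleaux.1 hx j)
  have hs := sum_bary a x
  rw [sum_eq_of_nodup h] at hs hdi hdj
  have hν' : 0 < ν⁻¹ := inv_pos.2 hν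
  have hji : bary a j x ≤ 1 + bary a i x :=
    abs_le_of_sq_le_sq' (by nlinarith [sq_nonneg (bary a i x)]) (by linarith) |>.2
  have hij' : bary a i x ≤ 1 + bary a j x :=
    abs_le_of_sq_le_sq' (by nlinarith [sq_nonneg (bary a j x)]) (by linarith) |>.2
  -- Comparing coordinates in `x = p + σ • (a i - p) + τ • (a j - p)` gives `σ + τ = 1 + ν⁻¹` and `σ
  -- - τ = bary a i x - bary a j x`.
  set σ := (bary a i x - bary a j x + 1 + ν⁻¹) / 2 with hσ
  set τ := (bary a j x - bary a i x + 1 + ν⁻¹) / 2 with hτ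
  have hσ0 : 0 ≤ σ := by linarith
  have hτ0 : 0 ≤ τ := by linarith
  have hνν : ν⁻¹ * ν = 1 := inv_mul_cancel₀ hν.ne'
  have e : x - p = σ • (a i - p) + τ • (a j - p) := by
    apply eq_of_lin_eq ha
    intro n
    simp only [lin_add, lin_smul, lin_vsub, bary_vertex ha]
    rcases eq_of_nodup h n with rfl | rfl | rfl | rfl
    · simp only [hij.symm, if_true, if_false, hpi, hσ, hτ]
      linear_combination (1 / 2) * (bary a k x + bary a l x) * hνν + (1 / 2) * hs
    · simp only [hij, if_true, if_false, hpj, hσ, hτ]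
      linear_combination (1 / 2) * (bary a k x + bary a l x) * hνν + (1 / 2) * hs
    · simp only [hik, hjk, if_false, hpk, hσ, hτ]
      linear_combination (-bary a n x) * hνν
    · simp only [hil, hjl, if_false, hpl, hσ, hτ]
      linear_combination (-bary a n x) * hνν
  rcases (hd p hp).eq_or_lt with h1 | h1
  · exact Or.inl ((mem_spindlePiece ha h).2 ⟨p, hp, h1, σ, τ, hσ0, hτ0, e⟩)
  · refine Or.inr fun z hz => ?_
    have hzR := mem_reuleaux.1 hz
    rw [dist_comm]
    refine (dist_le_of_mem_cone hσ0 hτ0 le_rfl (by linarith) (t₃ := a j) ?_ hi1 hj1 hj1 (hzR i)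
      (hzR j) (hzR j)).trans_lt h1
    rw [e, zero_smul, add_zero]

/-- In a selected wedge, `mem_spindlePiece_or_dist_lt` leaves only the spindle piece, as some centre
is at distance one. Outside these wedges, contact with a ball centred on an edge implies contact
with one centred at an end of it. -/
theorem subset_surgeredSurface {a : Fin 4 → E3} (ha : IsUnitTetrahedron a)
    (S : Set (Sym2 (Fin 4))) :
    frontier (ballInter (ballCenters a S)) ⊆ surgeredSurface a S := by
  intro x hx
  obtain ⟨hxM, p, hp, hd⟩ := (mem_frontier_ballInter (isCompact_ballCenters ha S)).1 hx
  have hxR := ballInter_ballCenters_subset a S hxM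
  by_cases H : ∃ i j k l, IsLabelling S i j k l ∧ bary a k x < 0 ∧ bary a l x < 0
  · obtain ⟨i, j, k, l, h, hk, hl⟩ := H
    rcases mem_spindlePiece_or_dist_lt ha h.1 hxR
      (fun q hq => mem_ballInter.1 hxM q (Or.inr ⟨i, j, k, l, h, hq⟩)) hk hl with h1 | h1
    · exact Or.inr ⟨i, j, k, l, h, h1⟩
    · exact absurd hd (h1 p (ballCenters_subset_reuleaux ha S hp)).ne
  · refine Or.inl ⟨mem_frontier_reuleaux.2 ⟨hxR, ?_⟩, fun i j k l h hr =>
      H ⟨i, j, k, l, h, ((mem_edgeRegion ha h.1).1 hr).2⟩⟩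
    rcases hp with ⟨n, rfl⟩ | ⟨i, j, k, l, h, hp⟩
    · exact ⟨n, hd⟩
    · rcases dist_edge_le ha h.1 hp fun hn => H ⟨i, j, k, l, h, hn⟩ with h1 | h1
      · exact ⟨k, le_antisymm (mem_reuleaux.1 hxR k) (hd ▸ h1)⟩
      · exact ⟨l, le_antisymm (mem_reuleaux.1 hxR l) (hd ▸ h1)⟩

theorem frontier_ballInter_ballCenters {a : Fin 4 → E3} (ha : IsUnitTetrahedron a)
    (S : Set (Sym2 (Fin 4))) :
    frontier (ballInter (ballCenters a S)) = surgeredSurface a S :=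
  (subset_surgeredSurface ha S).antisymm (surgeredSurface_subset ha S)

/-! ### Diameter at most one, and constant width. -/

/-- In the face opposite to `a n`, a point beyond the plane opposite to `a l` lies on the spherical
segment between `a l` and a point of the edge from `a i` to `a j`. -/
theorem dist_le_one_of_bary_neg {a : Fin 4 → E3} (ha : IsUnitTetrahedron a) {i j n l : Fin 4}
    (h : [l, n, i, j].Nodup) {x z : E3} (hx : x ∈ reuleaux a) (hn : dist x (a n) = 1)
    (hl : bary a l x < 0) (hzl : dist z (a l) ≤ 1) (hz : ∀ p ∈ edge a i j, dist z p ≤ 1) :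
    dist z x ≤ 1 := by
  obtain ⟨hln, hli, hlj, hni, hnj, hij⟩ := nodup_ne h
  have h1 : [i, j, n, l].Nodup := by
    clear hx hl hn hzl hz; revert h; revert i j n l; decide
  have h2 : [j, i, n, l].Nodup := by
    clear hx hl hn hzl hz h1; revert h; revert i j n l; decide
  have hdn := (dist_vertex_eq_iff ha x n).1 hn
  have hdl := (dist_vertex_le_iff ha x l).1 (mem_reuleaux.1 hx l)
  have hnl : bary a n x ≤ bary a l x := by linarith
  have hi := nonneg_of_mem_reuleaux ha h1 hx (by linarith) hl.le
  have hj := nonneg_of_mem_reuleaux ha h2 hx (by linarith) hl.le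
  have hs := sum_bary a x
  rw [sum_eq_of_nodup h] at hs hdn
  obtain ⟨ν, hν, hν2, t, ht, hti, htj, htl, htn⟩ := exists_mem_edge ha h hi hj (by linarith)
  have hν' : 0 < ν⁻¹ := inv_pos.2 hν
  have hνν : ν⁻¹ * ν = 1 := inv_mul_cancel₀ hν.ne'
  -- On the sphere about `a n` the quadratic form of the edge equals `4 - (1 + bary a l x - bary a n
  -- x) ^ 2`, which is at most `3` because `bary a n x ≤ bary a l x`. This makes the coefficient `β`
  -- nonnegative.
  have hν1 : ν⁻¹ ≤ 1 := by
    apply inv_le_one_of_one_le₀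
    have e : 3 * bary a i x ^ 2 + 3 * bary a j x ^ 2 + 2 * bary a i x * bary a j x =
        4 - (1 + bary a l x - bary a n x) ^ 2 := by
      have e1 : bary a i x = 1 - bary a l x - bary a n x - bary a j x := by linarith
      rw [e1] at hdn ⊢
      linear_combination 2 * hdn
    rw [e] at hν2
    by_contra! hlt
    have h3 : ν ^ 2 < 1 := by nlinarith
    have h4 : 4 - (1 + bary a l x - bary a n x) ^ 2 ≤ 3 := by nlinarith
    linarith [mul_le_mul_of_nonneg_left h4 (sq_nonneg ν)]
  set β := (1 + bary a l x - bary a n x - ν⁻¹) / 2 with hβ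
  have hβ0 : 0 ≤ β := by linarith
  have e : x - a n = ν⁻¹ • (t - a n) + β • (a l - a n) + (0 : ℝ) • (a l - a n) := by
    rw [zero_smul, add_zero]
    apply eq_of_lin_eq ha
    intro m
    simp only [lin_add, lin_smul, lin_vsub, bary_vertex ha]
    rcases eq_of_nodup h m with rfl | rfl | rfl | rfl
    · simp only [hln.symm, if_true, if_false, htl, hβ]
      linear_combination (1 / 2) * (bary a i x + bary a j x) * hνν + (1 / 2) * hs
    · simp only [hln, if_true, if_false, htn, hβ]
      linear_combination (1 / 2) * (bary a i x + bary a j x) * hνν + (1 / 2) * hs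
    · simp only [hli, hni, if_false, hti]
      linear_combination (-bary a m x) * hνν
    · simp only [hlj, hnj, if_false, htj]
      linear_combination (-bary a m x) * hνν
  have htn1 := ((mem_edge h).1 ht).2.2
  have hln1 := ha l n hln
  rw [← hn]
  exact dist_le_of_mem_cone hν'.le hβ0 le_rfl
    (one_le_of_dist_eq_one hν'.le hβ0 le_rfl e htn1 hln1 hln1 hn) e htn1 hln1 hln1 (hz t ht) hzl hzl

theorem exists_nodup_one (n : Fin 4) : ∃ i j l, [i, j, l, n].Nodup := by
  revert n; decide

theorem exists_nodup_two {l n : Fin 4} (h : l ≠ n) : ∃ i j, [l, n, i, j].Nodup := by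
  revert h; revert l n; decide

/-- A retained face point is in the spherical triangle of three vertices, or lies near an edge
without surgery. In the second case the opposite edge is selected, so the points of the near edge
are centres and bound `z`. -/
theorem dist_le_one_of_mem_surgeredSurface {a : Fin 4 → E3} (ha : IsUnitTetrahedron a)
    {S : Set (Sym2 (Fin 4))} (hS : IsSelection S) {x z : E3} (hx : x ∈ surgeredSurface a S)
    (hz : z ∈ ballInter (ballCenters a S)) : dist z x ≤ 1 := by
  have hzR := mem_reuleaux.1 (ballInter_ballCenters_subset a S hz)
  rcases hx with ⟨hfr, hx⟩ | ⟨i, j, k, l, h, hx⟩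
  · obtain ⟨hxR, n, hn⟩ := mem_frontier_reuleaux.1 hfr
    by_cases H : ∃ l, l ≠ n ∧ bary a l x < 0
    · obtain ⟨l, hln, hl⟩ := H
      obtain ⟨i, j, h⟩ := exists_nodup_two hln
      have h' : [i, j, n, l].Nodup := by
        clear hx hl hln hn hfr; revert h; revert i j n l; decide
      have hdn := (dist_vertex_eq_iff ha x n).1 hn
      have hdl := (dist_vertex_le_iff ha x l).1 (mem_reuleaux.1 hxR l)
      have hijS : s(i, j) ∉ S := fun hmem => hx i j n l ⟨h', hmem⟩
        ((mem_edgeRegion ha h').2 ⟨hfr, by linarith, hl⟩)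
      have hlnS := (hS l n i j h).2 hijS
      exact dist_le_one_of_bary_neg ha h hxR hn hl (hzR l) fun p hp =>
        mem_ballInter.1 hz p (Or.inr ⟨l, n, i, j, ⟨h, hlnS⟩, hp⟩)
    · push Not at H
      obtain ⟨i, j, l, h⟩ := exists_nodup_one n
      obtain ⟨hij, hil, hin, hjl, hjn, hln⟩ := nodup_ne h
      have e : x - a n = bary a i x • (a i - a n) + bary a j x • (a j - a n) +
          bary a l x • (a l - a n) := by
        apply eq_of_lin_eq ha
        intro m
        have hs := sum_bary a x
        rw [sum_eq_of_nodup h] at hs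
        simp only [lin_add, lin_smul, lin_vsub, bary_vertex ha]
        rcases eq_of_nodup h m with rfl | rfl | rfl | rfl <;>
        simp [hij, hij.symm, hil, hil.symm, hin, hin.symm, hjl, hjl.symm, hjn, hjn.symm, hln,
          hln.symm]
        linarith
      rw [← hn]
      exact dist_le_of_mem_cone (H i hin) (H j hjn) (H l hln)
        (one_le_of_dist_eq_one (H i hin) (H j hjn) (H l hln) e (ha i n hin) (ha j n hjn)
          (ha l n hln) hn) e (ha i n hin) (ha j n hjn) (ha l n hln) (hzR i) (hzR j) (hzR l)
  · exact (exists_edge_of_mem_spindlePiece ha h.1 hx).2 z (hzR i) (hzR j)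

theorem hasConstantWidth_ballInter_ballCenters {a : Fin 4 → E3} (ha : IsUnitTetrahedron a)
    {S : Set (Sym2 (Fin 4))} (hS : IsSelection S) :
    HasConstantWidth (ballInter (ballCenters a S)) := by
  have hsub := ballCenters_subset_ballInter ha hS
  refine hasConstantWidth_of_eq_ballInter ⟨a 0, hsub (vertex_mem_ballCenters a S 0)⟩
    (subset_antisymm ?_ ?_)
  · refine subset_ballInter_self (convex_ballInter _)
      (isCompact_ballInter ⟨a 0, vertex_mem_ballCenters a S 0⟩) fun x hx z hz => ?_
    exact dist_le_one_of_mem_surgeredSurface ha hS (subset_surgeredSurface ha S hx) hz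
  · exact fun x hx => mem_ballInter.2 fun p hp => mem_ballInter.1 hx p (hsub hp)

theorem isSurgeredBody_iff {a : Fin 4 → E3} (ha : IsUnitTetrahedron a)
    (S : Set (Sym2 (Fin 4))) {M : Set E3} :
    IsSurgeredBody a S M ↔ M = ballInter (ballCenters a S) := by
  have hc := convex_ballInter (ballCenters a S)
  have hK := isCompact_ballInter ⟨a 0, vertex_mem_ballCenters a S 0⟩
  have hf := frontier_ballInter_ballCenters ha S
  constructor
  · rintro ⟨h1, h2, h3⟩
    rw [← closure_convexHull_frontier h1 h2, h3, ← hf, closure_convexHull_frontier hc hK]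
  · rintro rfl
    exact ⟨hc, hK, hf⟩

/-! ### Three edges of a face, three edges at a vertex. -/

/-- Every vertex is an end of exactly one edge of each opposite pair. -/
theorem isSelection_face (k : Fin 4) : IsSelection {e | k ∉ e} := by
  intro i j l m h
  simp only [mem_ofPred_eq, Sym2.mem_iff]
  revert h; revert i j l m k; decide

theorem isSelection_vertex (k : Fin 4) : IsSelection {e | k ∈ e} := by
  intro i j l m h
  simp only [mem_ofPred_eq, Sym2.mem_iff]
  revert h; revert i j l m k; decide

theorem edge_comm (a : Fin 4 → E3) (i j : Fin 4) : edge a i j = edge a j i := by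
  rw [edge, edge, pair_comm]

theorem vertex_mem_edge {a : Fin 4 → E3} (ha : IsUnitTetrahedron a) (i j : Fin 4) :
    a i ∈ edge a i j := by
  refine mem_iInter₂.2 fun k hk => ⟨ha i k ?_, vertex_mem_reuleaux ha i⟩
  rintro rfl
  exact hk (mem_insert _ _)

theorem ballCenters_face (a : Fin 4 → E3) (k : Fin 4) :
    ballCenters a {e | k ∉ e} = range a ∪ edgesAtVertex a k := by
  refine congrArg (range a ∪ ·) (Set.ext fun x => ⟨?_, ?_⟩)
  · rintro ⟨i, j, l, m, ⟨h, hk⟩, hx⟩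
    obtain ⟨-, -, -, -, -, hlm⟩ := nodup_ne h
    simp only [mem_ofPred_eq, Sym2.mem_iff, not_or] at hk
    rcases eq_of_nodup h k with rfl | rfl | rfl | rfl
    · exact absurd rfl hk.1
    · exact absurd rfl hk.2
    · exact ⟨m, hlm.symm, hx⟩
    · exact ⟨l, hlm, edge_comm a l k ▸ hx⟩
  · rintro ⟨j, hjk, hx⟩
    obtain ⟨i, l, h⟩ := exists_nodup_two hjk
    obtain ⟨-, -, -, hki, hkl, -⟩ := nodup_ne h
    refine ⟨i, l, k, j, ⟨?_, ?_⟩, hx⟩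
    · clear hjk hx hki hkl; revert h; revert i j k l; decide
    · simp [hki, hkl]

theorem ballCenters_vertex (a : Fin 4 → E3) (k : Fin 4) :
    ballCenters a {e | k ∈ e} = range a ∪ edgesOfFace a k := by
  refine congrArg (range a ∪ ·) (Set.ext fun x => ⟨?_, ?_⟩)
  · rintro ⟨i, j, l, m, ⟨h, hk⟩, hx⟩
    obtain ⟨-, hil, him, hjl, hjm, hlm⟩ := nodup_ne h
    simp only [mem_ofPred_eq, Sym2.mem_iff] at hk
    rcases hk with rfl | rfl
    · exact ⟨l, m, hlm, hil.symm, him.symm, hx⟩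
    · exact ⟨l, m, hlm, hjl.symm, hjm.symm, hx⟩
  · rintro ⟨i, j, hij, hik, hjk, hx⟩
    obtain ⟨l, m, h⟩ := exists_nodup_two hij
    rcases eq_of_nodup h k with rfl | rfl | rfl | rfl
    · exact absurd rfl hik
    · exact absurd rfl hjk
    · refine ⟨k, m, i, j, ⟨?_, by simp⟩, hx⟩
      clear hij hik hjk hx; revert h; revert i j k m; decide
    · refine ⟨k, l, i, j, ⟨?_, by simp⟩, hx⟩
      clear hij hik hjk hx; revert h; revert i j k l; decide

theorem range_union_edgesAtVertex {a : Fin 4 → E3} (ha : IsUnitTetrahedron a) (k : Fin 4) :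
    range a ∪ edgesAtVertex a k = edgesAtVertex a k := by
  refine union_eq_self_of_subset_left ?_
  rintro _ ⟨n, rfl⟩
  rcases eq_or_ne n k with rfl | h
  · obtain ⟨j, hj⟩ := exists_ne n
    exact ⟨j, hj, vertex_mem_edge ha n j⟩
  · exact ⟨n, h, edge_comm a n k ▸ vertex_mem_edge ha n k⟩

theorem range_union_edgesOfFace {a : Fin 4 → E3} (ha : IsUnitTetrahedron a) (k : Fin 4) :
    range a ∪ edgesOfFace a k = {a k} ∪ edgesOfFace a k := by
  refine subset_antisymm (union_subset ?_ subset_union_right)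
    (union_subset_union_left _ (singleton_subset_iff.2 ⟨k, rfl⟩))
  rintro _ ⟨n, rfl⟩
  rcases eq_or_ne n k with rfl | h
  · exact Or.inl rfl
  · obtain ⟨j, l, hj⟩ := exists_nodup_two h
    obtain ⟨-, hnj, -, hkj, -, -⟩ := nodup_ne hj
    exact Or.inr ⟨n, j, hnj, h, hkj.symm, vertex_mem_edge ha n j⟩

end Meissner

end

theorem mainTheorem5 (a : Fin 4 → Meissner.E3) (ha : Meissner.IsUnitTetrahedron a) (k : Fin 4) :
    ((∃ M, Meissner.IsMeissnerFace a k M) ∧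
      ∀ M, Meissner.IsMeissnerFace a k M →
        Meissner.HasConstantWidth M ∧
        M = Meissner.ballInter (Set.range a ∪ Meissner.edgesAtVertex a k) ∧
        M = Meissner.ballInter (Meissner.edgesAtVertex a k)) ∧
    ((∃ M, Meissner.IsMeissnerVertex a k M) ∧
      ∀ M, Meissner.IsMeissnerVertex a k M →
        Meissner.HasConstantWidth M ∧
        M = Meissner.ballInter (Set.range a ∪ Meissner.edgesOfFace a k) ∧
        M = Meissner.ballInter ({a k} ∪ Meissner.edgesOfFace a k)) := by
  have hf := Meissner.isSelection_face k
  have hv := Meissner.isSelection_vertex k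
  refine ⟨⟨⟨_, (Meissner.isSurgeredBody_iff ha _).2 rfl⟩, fun M hM => ?_⟩,
    ⟨_, (Meissner.isSurgeredBody_iff ha _).2 rfl⟩, fun M hM => ?_⟩
  · obtain rfl := (Meissner.isSurgeredBody_iff ha _).1 hM
    refine ⟨Meissner.hasConstantWidth_ballInter_ballCenters ha hf, ?_, ?_⟩
    · rw [Meissner.ballCenters_face]
    · rw [Meissner.ballCenters_face, Meissner.range_union_edgesAtVertex ha]
  · obtain rfl := (Meissner.isSurgeredBody_iff ha _).1 hM
    refine ⟨Meissner.hasConstantWidth_ballInter_ballCenters ha hv, ?_, ?_⟩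
    · rw [Meissner.ballCenters_vertex]
    · rw [Meissner.ballCenters_vertex, Meissner.range_union_edgesOfFace ha]
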